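/- **Conventions.** Fix a field $\mathbb{F}$. A zigzag module $\mathbb{V}$ is a representation, by finite-dimensional $\mathbb{F}$-vector spaces $V_k$, of a quiver with vertices $0,\dots,n$ and one arrow, forward or backward, between $k$ and $k+1$ for each $k<n$. For $s<t$ put $s\le_{\mathrm b}t$ if the arrow between $t-1$ and $t$ is forward, and $t\le_{\mathrm b}s$ otherwise; put $s\le_{\mathrm d}t$ if the arrow between $s$ and $s+1$ is forward, and $t\le_{\mathrm d}s$ otherwise. A sequence $(x_k)_k$, $x_k\in V_k$, is a representative sequence with interval $[b;d]$ for $v\in V_m$ if $x_m=v$, if $x_k\ne0$ exactly for $b\le k\le d$, and if the map of every arrow whose source entry is non-zero sends the source entry to the target entry; equivalently, the lines $\mathbb{F}x_k$ form a submodule isomorphic, through the $x_k$, to the interval module $\mathbb{I}[b;d]$. A basis $(v_j)$ of $V_m$ is compatible with a decomposition of $\mathbb{V}$ into an internal direct sum of interval submodules if each $v_j$ has a representative sequence that spans one of the summands; this summand $\mathbb{I}[b_j;d_j]$ is then attached to $v_j$. All cochains, $C^*$ and $H^*$ are simplicial with coefficients in $\mathbb{F}$, taken in all degrees together, and complexes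 are finite. Let $0<i<n$, and let $$\emptyset=K_0\leftrightarrow\cdots\leftrightarrow K_{i-1}\to K_i\leftarrow K_{i+1}\leftarrow\cdots\leftarrow K_n=\emptyset$$ be a zigzag of inclusions of complexes with $K_{i-1}=K_i=K_{i+1}=:K$, in which every arrow, except the two identities at $i$, is the insertion or the deletion of exactly one simplex, and all arrows to the right of $i$ point left. Let $K\cup\{\sigma\}$ be a complex with $\sigma\notin K$. Let $\mathbb{V}$ (bottom) be the cohomology zigzag module of this filtration and $\mathbb{W}$ (top) that of the filtration obtained by replacing $K_i$ by $K\cup\{\sigma\}$ (both have the same arrow orientations, hence the same orders $\le_{\mathrm b},\le_{\mathrm d}$). **Lemma.** Assume that the restriction map $\sigma^*:H^*(K\cup\{\sigma\})\to H^*(K)$ is injective. Let $\alpha_1,\dots,\alpha_N$ be cocycles of $K$ such that $([\alpha_j])_j$ is a basis of $H^*(K)$ at vertex $i$ compatible with an interval decomposition of $\mathbb{V}$, with $\mathbb{I}[b_j;d_j]$ attached to $[\alpha_j]$. Put $c_j=(\delta\alpha_j)(\sigma)=\alpha_j(\partial\sigma)$, and suppose the $\alpha_j$ are ordered so that $c_j\neq0$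 exactly for $j\le p$, and $d_1\ge_{\mathrm d}\cdots\ge_{\mathrm d}d_p$. Run the following procedure. Choose $\ell_p\in\{1,\dots,p\}$ with $b_{\ell_p}$ minimal for $\le_{\mathrm b}$ among $b_1,\dots,b_p$, and declare $b_{\ell_p}$ paired (with $d_p$). For $j=1,\dots,p-1$: * if $b_j$ is not yet paired, put $\ell_j=j$, pair $b_j$ with $d_j$, choose any $j_0\in\{1,\dots,p\}$, $j_0\ne j$, with $b_{j_0}\le_{\mathrm b}b_j$ and $d_{j_0}\le_{\mathrm d}d_j$, and put $\alpha'_j=\alpha_j-\frac{c_j}{c_{j_0}}\alpha_{j_0}$; * otherwise choose $\ell_j\in\{1,\dots,p\}$ with $b_{\ell_j}$ minimal for $\le_{\mathrm b}$ among the $b_k$, $k\le p$, not yet paired, pair $b_{\ell_j}$ with $d_j$, and put $\alpha'_j=\alpha_j-\frac{c_j}{c_{\ell_j}}\alpha_{\ell_j}$. Put $\alpha'_j=\alpha_j$ and $\ell_j=j$ for $j>p$, and extend every $\alpha'_j$ $(j\neq p)$ to $K\cup\{\sigma\}$ by $\alpha'_j(\sigma)=0$. Then $p\ge1$ and the procedure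 can be executed to the end (all the choices it asks for exist). Moreover, for every execution, the $\alpha'_j$ $(j\ne p)$ are cocycles of $K\cup\{\sigma\}$ and there is one decomposition of $\mathbb{W}$ as an internal direct sum of interval submodules such that: 1. $([\alpha'_j])_{j\neq p}$ is a basis of $H^*(K\cup\{\sigma\})$ at vertex $i$ compatible with this decomposition, and the summand attached to $[\alpha'_j]$ is $\mathbb{I}[b_{\ell_j};d_j]$; 2. $[\alpha_{\ell_p}]\in H^*(K)$ at vertex $i-1$ and $[\alpha_p]\in H^*(K)$ at vertex $i+1$ are attached to summands $\mathbb{I}[b_{\ell_p};i-1]$ and $\mathbb{I}[i+1;d_p]$, respectively. -/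

import Mathlib

/-! ### Zigzag modules over type `A` quivers -/

/-- A zigzag module: a representation, by finite dimensional `F`-vector spaces, of a quiver of type
`A` with vertices `0, …, n` and one arrow between `k.castSucc` and `k.succ` for every `k : Fin n`,
pointing forward (`k.castSucc ⟶ k.succ`) or backward (`k.castSucc ⟵ k.succ`). -/
structure ZigzagModule (F : Type*) [Field F] (n : ℕ) where
  /-- orientation of the arrows -/
  forward : Fin n → Bool
  /-- the vector space at each vertex -/
  V : Fin (n + 1) → Type*
  [addCommGroup : ∀ k, AddCommGroup (V k)]
  [module : ∀ k, Module F (V k)]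
  [finite : ∀ k, Module.Finite F (V k)]
  /-- the linear map on a forward arrow -/
  fmap : ∀ k, forward k = true → V k.castSucc →ₗ[F] V k.succ
  /-- the linear map on a backward arrow -/
  bmap : ∀ k, forward k = false → V k.succ →ₗ[F] V k.castSucc

attribute [instance] ZigzagModule.addCommGroup ZigzagModule.module ZigzagModule.finite

namespace ZigzagModule

variable {F : Type*} [Field F] {n : ℕ}

/-- The birth order of the quiver: for `i < j`, `i ≤ j` in the birth order if the arrow
between `j - 1` and `j` is forward, and `j ≤ i` in the birth order otherwise. -/
def leB (M : ZigzagModule F n) (i j : Fin (n + 1)) : Prop :=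
  i = j ∨ (i < j ∧ ∃ k : Fin n, k.succ = j ∧ M.forward k = true) ∨
    (j < i ∧ ∃ k : Fin n, k.succ = i ∧ M.forward k = false)

/-- The death order of the quiver: for `i < j`, `i ≤ j` in the death order if the arrow
between `i` and `i + 1` is forward, and `j ≤ i` in the death order otherwise. -/
def leD (M : ZigzagModule F n) (i j : Fin (n + 1)) : Prop :=
  i = j ∨ (i < j ∧ ∃ k : Fin n, k.castSucc = i ∧ M.forward k = true) ∨
    (j < i ∧ ∃ k : Fin n, k.castSucc = j ∧ M.forward k = false)

/-- `x` is a representative sequence of `M` with interval `[b; d]`: its non-zero entries are exactly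
those with index in `[b; d]`, and the map of each arrow sends the entry at the source of the arrow,
if it is not zero, to the entry at the target. This says precisely that the lines spanned by the
entries are a submodule of `M`, isomorphic to the interval module `𝕀[b; d]` through the basis `x`.
(At an end of the interval where the arrow points into the interval, the source entry is zero and
nothing is required.) -/
structure IsRepSeq (M : ZigzagModule F n) (x : ∀ k, M.V k) (b d : Fin (n + 1)) : Prop where
  le : b ≤ d
  ne_zero_iff : ∀ k, x k ≠ 0 ↔ b ≤ k ∧ k ≤ d
  map_forward : ∀ k (h : M.forward k = true),
    x k.castSucc ≠ 0 → M.fmap k h (x k.castSucc) = x k.succ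
  map_backward : ∀ k (h : M.forward k = false),
    x k.succ ≠ 0 → M.bmap k h (x k.succ) = x k.castSucc

/-- A decomposition of `M` as an internal direct sum of interval submodules, the `s`-th of them
being spanned by the representative sequence `x s` with interval `[b s; d s]`. At every vertex `k`
the (one-dimensional) non-zero spaces of the summands are in direct sum and fill `M.V k`. -/
structure IntervalDecomposition (M : ZigzagModule F n) where
  /-- the number of summands -/
  size : ℕ
  /-- representative sequences that span the summands -/
  x : Fin size → ∀ k, M.V k
  /-- births -/
  b : Fin size → Fin (n + 1)
  /-- deaths -/
  d : Fin size → Fin (n + 1)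
  isRepSeq : ∀ s, M.IsRepSeq (x s) (b s) (d s)
  linearIndependent : ∀ k,
    LinearIndependent F (fun s : {s : Fin size // b s ≤ k ∧ k ≤ d s} => x s.1 k)
  span_eq_top : ∀ k,
    Submodule.span F (Set.range fun s : {s : Fin size // b s ≤ k ∧ k ≤ d s} => x s.1 k) = ⊤

namespace IntervalDecomposition

variable {M : ZigzagModule F n}

/-- A summand with interval `[b; d]` of the decomposition is attached to the vector `v` at
vertex `k`: it is spanned by a representative sequence for `v`. -/
def Attached (D : M.IntervalDecomposition) (k : Fin (n + 1)) (v : M.V k) (b d : Fin (n + 1)) :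
    Prop :=
  ∃ s, D.x s k = v ∧ D.b s = b ∧ D.d s = d

/-- The family `v` is a basis of the space at vertex `k` that is compatible with the decomposition,
a summand with interval `[b j; d j]` being attached to `v j`. -/
structure IsCompatibleBasis (D : M.IntervalDecomposition) (k : Fin (n + 1)) {ι : Type*}
    (v : ι → M.V k) (b d : ι → Fin (n + 1)) : Prop where
  linearIndependent : LinearIndependent F v
  span_eq_top : Submodule.span F (Set.range v) = ⊤
  attached : ∀ j, D.Attached k (v j) (b j) (d j)

end IntervalDecomposition

end ZigzagModule

/-! ### Simplicial cohomology (all degrees together) -/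

section Cohomology

variable (F : Type*) [Field F] {X : Type*} [LinearOrder X]

/-- Cochains of all degrees of the complex `K`, with coefficients in `F`. -/
abbrev Cochain (K : PreAbstractSimplicialComplex X) : Type _ := K.faces → F

open Classical in
/-- The simplicial coboundary: `(δ α)(τ) = α(∂ τ)`, where the boundary of `τ = {v₀ < ⋯ < v_q}` is
`∑ₘ (-1)ᵐ (τ \ {vₘ})`. (A vertex has boundary `0`: the empty set is not a face.) -/
noncomputable def coboundary (K : PreAbstractSimplicialComplex X) :
    Cochain F K →ₗ[F] Cochain F K where
  toFun α τ := ∑ v ∈ τ.1, (-1 : F) ^ (τ.1.filter (· < v)).card *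
    (if h : τ.1.erase v ∈ K.faces then α ⟨τ.1.erase v, h⟩ else 0)
  map_add' α β := by
    funext τ
    simp only [Pi.add_apply]
    rw [← Finset.sum_add_distrib]
    refine Finset.sum_congr rfl fun v _ => ?_
    split_ifs <;> ring
  map_smul' a α := by
    funext τ
    simp only [Pi.smul_apply, smul_eq_mul, RingHom.id_apply]
    rw [Finset.mul_sum]
    refine Finset.sum_congr rfl fun v _ => ?_
    split_ifs <;> ring

/-- The total cohomology `H^*(K)`: cocycles modulo coboundaries. -/
abbrev Cohomology (K : PreAbstractSimplicialComplex X) : Type _ :=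
  LinearMap.ker (coboundary F K) ⧸
    (LinearMap.range (coboundary F K)).submoduleOf (LinearMap.ker (coboundary F K))

variable {F}

/-- The cohomology class of a cocycle. -/
noncomputable def cohClass {K : PreAbstractSimplicialComplex X} (α : Cochain F K) (h : coboundary F K α = 0) :
    Cohomology F K :=
  Submodule.Quotient.mk ⟨α, h⟩

open Classical in
/-- The cochain on `L` that agrees with `α` on the simplices of `K` and vanishes on all other
simplices of `L`. -/
noncomputable def Cochain.extend {K : PreAbstractSimplicialComplex X}
    (L : PreAbstractSimplicialComplex X) (α : Cochain F K) : Cochain F L :=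
  fun τ => if h : τ.1 ∈ K.faces then α ⟨τ.1, h⟩ else 0

variable (F)

/-- Restriction of cochains to a subcomplex. -/
def cochainRes {K L : PreAbstractSimplicialComplex X} (h : K ≤ L) :
    Cochain F L →ₗ[F] Cochain F K where
  toFun α τ := α ⟨τ.1, h τ.2⟩
  map_add' _ _ := rfl
  map_smul' _ _ := rfl

theorem coboundary_cochainRes {K L : PreAbstractSimplicialComplex X} (h : K ≤ L)
    (α : Cochain F L) :
    coboundary F K (cochainRes F h α) = cochainRes F h (coboundary F L α) := by
  funext τ
  simp only [coboundary, cochainRes, LinearMap.coe_mk, AddHom.coe_mk]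
  refine Finset.sum_congr rfl fun v _ => ?_
  congr 1
  by_cases hL : τ.1.erase v ∈ L.faces
  · have hK : τ.1.erase v ∈ K.faces :=
      (K.isRelLowerSet_faces τ.2).2 (Finset.erase_subset _ _) (L.isRelLowerSet_faces hL).1
    rw [dif_pos hL, dif_pos hK]
  · have hK : τ.1.erase v ∉ K.faces := fun hK => hL (h hK)
    rw [dif_neg hL, dif_neg hK]

/-- Restriction of cocycles to a subcomplex. -/
noncomputable def cocycleRes {K L : PreAbstractSimplicialComplex X} (h : K ≤ L) :
    LinearMap.ker (coboundary F L) →ₗ[F] LinearMap.ker (coboundary F K) :=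
  (cochainRes F h).restrict fun α hα => by
    rw [LinearMap.mem_ker] at hα ⊢
    rw [coboundary_cochainRes, hα, map_zero]

/-- The map `H^*(L) → H^*(K)` induced by the inclusion of a subcomplex `K ≤ L`. -/
noncomputable def cohomologyMap {K L : PreAbstractSimplicialComplex X} (h : K ≤ L) :
    Cohomology F L →ₗ[F] Cohomology F K :=
  Submodule.mapQ _ _ (cocycleRes F h) (by
    rintro ⟨α, hα⟩ ⟨β, hβ⟩
    exact ⟨cochainRes F h β, by rw [coboundary_cochainRes, hβ]; rfl⟩)

end Cohomology

/-! ### Zigzag filtrations and the reversed reflection diamond -/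

/-- A zigzag of inclusions of finite simplicial complexes `K 0, …, K n`. -/
structure ZigzagFiltration (X : Type*) [LinearOrder X] (n : ℕ) where
  /-- the complexes -/
  K : Fin (n + 1) → PreAbstractSimplicialComplex X
  finite : ∀ k, (K k).faces.Finite
  /-- orientation of the inclusions -/
  forward : Fin n → Bool
  le_of_forward : ∀ k, forward k = true → K k.castSucc ≤ K k.succ
  le_of_backward : ∀ k, forward k = false → K k.succ ≤ K k.castSucc

theorem finite_cohomology (F : Type*) [Field F] {X : Type*} [LinearOrder X]
    (K : PreAbstractSimplicialComplex X) (h : K.faces.Finite) :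
    Module.Finite F (Cohomology F K) := by
  have : Finite K.faces := h
  infer_instance

/-- The zigzag module obtained by applying total cohomology; all arrows are reversed. -/
noncomputable def ZigzagFiltration.cohomology {X : Type*} [LinearOrder X] {n : ℕ}
    (B : ZigzagFiltration X n) (F : Type*) [Field F] : ZigzagModule F n where
  forward k := !B.forward k
  V k := Cohomology F (B.K k)
  finite k := finite_cohomology F (B.K k) (B.finite k)
  fmap k h := cohomologyMap F (B.le_of_backward k (by simpa using h))
  bmap k h := cohomologyMap F (B.le_of_forward k (by simpa using h))

/-- `L` is obtained from `K` by inserting one simplex, namely `σ`. -/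
def InsertSimplex {X : Type*} [LinearOrder X] (K L : PreAbstractSimplicialComplex X)
    (σ : Finset X) : Prop :=
  σ ∉ K.faces ∧ L.faces = insert σ K.faces

/-- `B` (bottom) and `T` (top) are the filtrations
```
   B :  ∅ ⟷ ⋯ ⟷ K ⟶   K   ⟵ K ⟵ K' ⟵ ⋯ ⟵ ∅
   T :  ∅ ⟷ ⋯ ⟷ K ⟶ K ∪ σ ⟵ K ⟵ K' ⟵ ⋯ ⟵ ∅
                l     i     r
```
which differ only at the vertex `i`: up to `l` simplices are inserted or deleted one at a time, and
from `r` on the simplices of `K` are removed one at a time. -/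
structure ReversedReflection {X : Type*} [LinearOrder X] {n : ℕ} (B T : ZigzagFiltration X n)
    (l i r : Fin (n + 1)) (σ : Finset X) : Prop where
  l_add_one : (l : ℕ) + 1 = i
  i_add_one : (i : ℕ) + 1 = r
  first : (B.K 0).faces = ∅
  last : (B.K (Fin.last n)).faces = ∅
  prefix_forward : ∀ k : Fin n, k.succ ≤ l → B.forward k = true →
    ∃ τ, InsertSimplex (B.K k.castSucc) (B.K k.succ) τ
  prefix_backward : ∀ k : Fin n, k.succ ≤ l → B.forward k = false →
    ∃ τ, InsertSimplex (B.K k.succ) (B.K k.castSucc) τ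
  left_eq : B.K l = B.K i
  right_eq : B.K r = B.K i
  left_arrow : ∀ k : Fin n, k.succ = i → B.forward k = true
  right_arrow : ∀ k : Fin n, k.castSucc = i → B.forward k = false
  suffix_arrow : ∀ k : Fin n, r ≤ k.castSucc → B.forward k = false
  suffix_backward : ∀ k : Fin n, r ≤ k.castSucc →
    ∃ τ, InsertSimplex (B.K k.succ) (B.K k.castSucc) τ
  top_forward : T.forward = B.forward
  top_eq : ∀ k, k ≠ i → T.K k = B.K k
  top_insert : InsertSimplex (B.K i) (T.K i) σ

namespace ReversedReflection

variable {X : Type*} [LinearOrder X] {n : ℕ} {B T : ZigzagFiltration X n}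
  {l i r : Fin (n + 1)} {σ : Finset X}

theorem le_top (h : ReversedReflection B T l i r σ) : B.K i ≤ T.K i := by
  intro τ hτ
  rw [h.top_insert.2]
  exact Set.mem_insert_of_mem _ hτ

theorem mem_top (h : ReversedReflection B T l i r σ) : σ ∈ (T.K i).faces := by
  rw [h.top_insert.2]
  exact Set.mem_insert _ _

/-- The scalar `c = (δ α)(σ) = α(∂ σ)` of a cochain `α` on `K`, extended by zero to `K ∪ {σ}`. -/
noncomputable def coeff {F : Type*} [Field F] (h : ReversedReflection B T l i r σ)
    (α : Cochain F (B.K i)) : F :=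
  coboundary F (T.K i) (α.extend (T.K i)) ⟨σ, h.mem_top⟩

end ReversedReflection

/-! ### The update algorithm -/

/-- An execution of the basis update algorithm. The input consists of cochains `α j` with scalars
`c j` and intervals `[b j; d j]` of the zigzag module `M`; the loop is over the first `p` indices
(here `0, …, p - 1`), which are sorted by decreasing death and of which `last = p - 1` comes last.

`ℓ` is the pairing: the birth with index `ℓ j` is paired with the death with index `j`. Before the
loop starts, the minimal birth, with index `ℓ last`, is paired with the death with index `last`.
So at iteration `j < last` the births already paired are those with index `ℓ last` or `ℓ m`,
`m < j`.

`α'` are the cochains computed. In the first case of the loop any pivot `j₀ ≠ j` among the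
first `p` indices that satisfies the two inequalities may be chosen. Indices beyond `last` are
left unchanged. (The value `α' last` is not part of the output.) -/
structure GreedyRun {F : Type*} [Field F] {n : ℕ} (M : ZigzagModule F n)
    {C : Type*} [AddCommGroup C] [Module F C] {N : ℕ} (p : ℕ)
    (α : Fin N → C) (c : Fin N → F) (b d : Fin N → Fin (n + 1)) where
  last : Fin N
  last_add_one : (last : ℕ) + 1 = p
  ℓ : Fin N → Fin N
  α' : Fin N → C
  ℓ_last_le : ℓ last ≤ last
  ℓ_last_min : ∀ k ≤ last, M.leB (b (ℓ last)) (b k)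
  /-- first case: the birth with index `j` is not yet paired -/
  step_unpaired : ∀ j < last, ¬ (j = ℓ last ∨ ∃ m < j, j = ℓ m) →
    ℓ j = j ∧ ∃ j₀ ≤ last, j₀ ≠ j ∧ M.leB (b j₀) (b j) ∧ M.leD (d j₀) (d j) ∧
      α' j = α j - (c j / c j₀) • α j₀
  /-- second case: the birth with index `j` is already paired -/
  step_paired : ∀ j < last, (j = ℓ last ∨ ∃ m < j, j = ℓ m) →
    ℓ j ≤ last ∧ ¬ (ℓ j = ℓ last ∨ ∃ m < j, ℓ j = ℓ m) ∧
      (∀ k ≤ last, ¬ (k = ℓ last ∨ ∃ m < j, k = ℓ m) → M.leB (b (ℓ j)) (b k)) ∧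
      α' j = α j - (c j / c (ℓ j)) • α (ℓ j)
  unchanged : ∀ j, last < j → ℓ j = j ∧ α' j = α j

/-!
The restriction maps `H^*(T.K k) → H^*(B.K k)` embed the top module `𝕎` into the bottom module `𝕍`
(`ReversedReflection.embedding`). The embedding is an isomorphism away from `i`, and at `i` its
image is the kernel of the form `c : [α] ↦ α(∂ σ)` (`InsertSimplex.mem_range_iff`). The form is not
zero: as `σ^*` is injective, the indicator cochain of `σ` is a coboundary, and a cochain that it
bounds restricts to a cocycle of `K` with `c = 1` (`InsertSimplex.connecting_ne_zero`). Hence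
`p ≥ 1`, and it suffices to change the decomposition of `𝕍` into one whose entries at `i` span
`ker c`.

Let `x j` be the representative sequence of `[α j]`. The combination `x j - a • x g` with
`a = c j / c g ≠ 0`, cut off at the ends of an interval `[b; d]`, is a representative sequence if
`b` is the later one of the two births and `d` the later one of the two deaths
(`IsRepSeq.linearCombination`). The algorithm picks its pivots such that these are the birth with
index `ℓ j` and the death with index `j` (`GreedyRun.exists_pivot`): an index that is paired ahead
of its own iteration was chosen as a minimum, so that its birth precedes all unpaired births, and
all indices less than the current one are paired. In the unpaired case a pivot exists by the
pigeonhole principle, since one more index is paired than there have been iterations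
(`IsGreedyPairing.exists_paired_ge`).

Every arrow outside the diamond inserts or deletes one simplex, so that its map in cohomology has
kernel and cokernel of dimension at most one. Hence the births of the classes at `i` are distinct,
and so are their deaths (`ReversedReflection.birth_ne`, `ReversedReflection.death_ne`). At a vertex
to the left of `i` the new sequences, indexed through `ℓ`, therefore arise from the old ones by a
change of basis that is triangular with respect to the births; the missing sequence with index
`ℓ last` is the left part of the old one. To the right of `i` the change of basis is triangular with
respect to the deaths, and the missing sequence is the right part of the old one with index `last`.
At `i` itself the new sequences are linearly independent by the latter triangularity, and there are
as many of them as the dimension of `ker c` (`UpdateData.exists_decomposition`).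
-/

/-! ### The greedy pairing -/

/-- The index `k` is paired before iteration `t`: it is the index `ℓ last` paired before the loop or
one of the indices `ℓ m` paired at an iteration `m < t`. -/
def Paired {N : ℕ} (ℓ : Fin N → Fin N) (last : Fin N) (t : ℕ) (k : Fin N) : Prop :=
  k = ℓ last ∨ ∃ m : Fin N, (m : ℕ) < t ∧ k = ℓ m

/-- The map `ℓ` obeys the rules of the update algorithm in the iterations before `t`, births being
compared through their ranks `rk`. -/
structure IsGreedyPairing {N : ℕ} (rk : Fin N → ℤ) (last : Fin N) (t : ℕ) (ℓ : Fin N → Fin N) :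
    Prop where
  last_le : ℓ last ≤ last
  last_min : ∀ k ≤ last, rk (ℓ last) ≤ rk k
  unpaired : ∀ j : Fin N, (j : ℕ) < t → ¬ Paired ℓ last j j → ℓ j = j
  paired : ∀ j : Fin N, (j : ℕ) < t → Paired ℓ last j j →
    ℓ j ≤ last ∧ ¬ Paired ℓ last j (ℓ j) ∧ ∀ k ≤ last, ¬ Paired ℓ last j k → rk (ℓ j) ≤ rk k

theorem Paired.mono {N : ℕ} {ℓ : Fin N → Fin N} {last k : Fin N} {s t : ℕ} (hst : s ≤ t)
    (h : Paired ℓ last s k) : Paired ℓ last t k := by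
  rcases h with h | ⟨m, hm, h⟩
  · exact Or.inl h
  · exact Or.inr ⟨m, hm.trans_le hst, h⟩

namespace IsGreedyPairing

variable {N : ℕ} {rk : Fin N → ℤ} {last : Fin N} {t : ℕ} {ℓ : Fin N → Fin N}

theorem mono (h : IsGreedyPairing rk last t ℓ) {s : ℕ} (hst : s ≤ t) :
    IsGreedyPairing rk last s ℓ :=
  { h with
    unpaired := fun k hk => h.unpaired k (hk.trans_le hst)
    paired := fun k hk => h.paired k (hk.trans_le hst) }

theorem le_last (h : IsGreedyPairing rk last t ℓ) (ht : t ≤ last) {j : Fin N} (hj : (j : ℕ) < t) :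
    ℓ j ≤ last := by
  by_cases hp : Paired ℓ last j j
  · exact (h.paired j hj hp).1
  · rw [h.unpaired j hj hp]
    exact Fin.le_def.2 (hj.le.trans ht)

theorem not_paired_apply (h : IsGreedyPairing rk last t ℓ) {j : Fin N} (hj : (j : ℕ) < t) :
    ¬ Paired ℓ last j (ℓ j) := by
  by_cases hp : Paired ℓ last j j
  · exact (h.paired j hj hp).2.1
  · rwa [h.unpaired j hj hp]

/-- Every index is paired as soon as its iteration is over. -/
theorem paired_of_lt (h : IsGreedyPairing rk last t ℓ) {j : Fin N} (hj : (j : ℕ) < t) :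
    Paired ℓ last t j := by
  by_cases hp : Paired ℓ last j j
  · exact hp.mono hj.le
  · exact Or.inr ⟨j, hj, (h.unpaired j hj hp).symm⟩

/-- An index that is paired ahead of its own iteration was chosen as a minimum, so that its birth
precedes all births that are still unpaired. -/
theorem rk_le_of_paired (h : IsGreedyPairing rk last t ℓ) {m k : Fin N} (hm : t ≤ m)
    (hmp : Paired ℓ last t m) (hk : k ≤ last) (hkp : ¬ Paired ℓ last t k) : rk m ≤ rk k := by
  rcases hmp with rfl | ⟨m', hm', rfl⟩
  · exact h.last_min k hk
  · have hp : Paired ℓ last m' m' := by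
      by_contra hp
      rw [h.unpaired m' hm' hp] at hm
      omega
    exact (h.paired m' hm' hp).2.2 k hk fun hk' => hkp (hk'.mono hm'.le)

theorem injOn (h : IsGreedyPairing rk last t ℓ) (ht : t ≤ last) :
    Set.InjOn ℓ {j | (j : ℕ) < t ∨ j = last} := by
  have key : ∀ j k : Fin N, (j : ℕ) < t → (k : ℕ) < t ∨ k = last →
      (j < k ∨ k = last → ℓ j ≠ ℓ k) := by
    rintro j k hj hk hjk he
    rcases hjk with hjk | rfl
    · rcases hk with hk | rfl
      · exact h.not_paired_apply hk (Or.inr ⟨j, hjk, he.symm⟩)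
      · exact h.not_paired_apply hj (Or.inl he)
    · exact h.not_paired_apply hj (Or.inl he)
  rintro j hj k hk he
  by_contra hne
  rcases hj with hj | rfl
  · rcases hk with hk | rfl
    · rcases lt_or_gt_of_ne hne with hlt | hlt
      · exact key j k hj (Or.inl hk) (Or.inl hlt) he
      · exact key k j hk (Or.inl hj) (Or.inl hlt) he.symm
    · exact key j k hj (Or.inr rfl) (Or.inr rfl) he
  · rcases hk with hk | rfl
    · exact key k j hk (Or.inr rfl) (Or.inr rfl) he.symm
    · exact hne rfl

/-- Before iteration `t < last` at most `t + 1` of the `last + 1` indices are paired. -/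
theorem exists_not_paired (ht : t < last) : ∃ k ≤ last, ¬ Paired ℓ last t k := by
  by_contra! hall
  have hsub : Finset.Iic last ⊆
      insert (ℓ last) ((Finset.Iio (⟨t, ht.trans last.2⟩ : Fin N)).image ℓ) := by
    intro k hk
    rcases hall k (Finset.mem_Iic.1 hk) with h | ⟨m, hm, h⟩
    · exact Finset.mem_insert.2 (Or.inl h)
    · exact Finset.mem_insert_of_mem
        (Finset.mem_image.2 ⟨m, Finset.mem_Iio.2 (Fin.lt_def.2 hm), h.symm⟩)
  have h1 := Finset.card_le_card hsub
  have h2 := Finset.card_insert_le (ℓ last)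
    ((Finset.Iio (⟨t, ht.trans last.2⟩ : Fin N)).image ℓ)
  have h3 := Finset.card_image_le (s := Finset.Iio (⟨t, ht.trans last.2⟩ : Fin N)) (f := ℓ)
  rw [Fin.card_Iio] at h3
  rw [Fin.card_Iic] at h1
  simp only at h3
  omega

/-- By the pigeonhole principle, some index paired before iteration `t` is not less than `t`. -/
theorem exists_paired_ge (h : IsGreedyPairing rk last t ℓ) (ht : t < last) :
    ∃ m : Fin N, t ≤ m ∧ m ≤ last ∧ Paired ℓ last t m := by
  by_contra! hall
  set u : Fin N := ⟨t, ht.trans last.2⟩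
  have hmaps : Set.MapsTo ℓ (↑(insert last (Finset.Iio u))) (↑(Finset.Iio u) : Set (Fin N)) := by
    intro j hj
    rw [Finset.coe_insert, Set.mem_insert_iff, Finset.mem_coe, Finset.mem_Iio] at hj
    rw [Finset.mem_coe, Finset.mem_Iio, Fin.lt_def]
    by_contra hge
    rcases hj with rfl | hj
    · exact hall (ℓ j) (not_lt.1 hge) h.last_le (Or.inl rfl)
    · exact hall (ℓ j) (not_lt.1 hge) (h.le_last ht.le hj) (Or.inr ⟨j, hj, rfl⟩)
  have hcard : (Finset.Iio u).card < (insert last (Finset.Iio u)).card := by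
    rw [Finset.card_insert_of_notMem]
    · omega
    · rw [Finset.mem_Iio, Fin.lt_def]
      exact not_lt.2 ht.le
  obtain ⟨x, hx, y, hy, hxy, he⟩ := Finset.exists_ne_map_eq_of_card_lt_of_maps_to hcard hmaps
  refine hxy (h.injOn ht.le ?_ ?_ he)
  · rcases Finset.mem_insert.1 hx with hx | hx
    · exact Or.inr hx
    · exact Or.inl (Fin.lt_def.1 (Finset.mem_Iio.1 hx))
  · rcases Finset.mem_insert.1 hy with hy | hy
    · exact Or.inr hy
    · exact Or.inl (Fin.lt_def.1 (Finset.mem_Iio.1 hy))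

/-- Every number of iterations up to `last` can be carried out. -/
theorem exists_of_le (rk : Fin N → ℤ) (last : Fin N) :
    ∀ t : ℕ, t ≤ last → ∃ ℓ, IsGreedyPairing rk last t ℓ ∧ ∀ j, last < j → ℓ j = j := by
  intro t
  induction t with
  | zero =>
    intro _
    obtain ⟨m, hm, hmin⟩ := Finset.exists_min_image (Finset.Iic last) rk
      ⟨last, Finset.mem_Iic.2 le_rfl⟩
    refine ⟨fun j => if last < j then j else m, ⟨?_, ?_, fun j hj => absurd hj (Nat.not_lt_zero _),
      fun j hj => absurd hj (Nat.not_lt_zero _)⟩, fun j hj => if_pos hj⟩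
    · simpa using hm
    · intro k hk
      simpa using hmin k (Finset.mem_Iic.2 hk)
  | succ t ih =>
    intro ht
    obtain ⟨ℓ, h, hgt⟩ := ih (Nat.le_of_succ_le ht)
    set u : Fin N := ⟨t, (Nat.lt_of_succ_le ht).trans last.2⟩
    have hul : last ≠ u := by
      rintro he
      have : (last : ℕ) = t := congrArg Fin.val he
      omega
    have hupd : ∀ v j : Fin N, (j : ℕ) < t → Function.update ℓ u v j = ℓ j := by
      intro v j hj
      refine Function.update_of_ne ?_ _ _
      rintro rfl
      exact lt_irrefl _ hj
    have hpair : ∀ (v : Fin N) (s : ℕ) (k : Fin N), s ≤ t →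
        (Paired (Function.update ℓ u v) last s k ↔ Paired ℓ last s k) := by
      intro v s k hs
      unfold Paired
      rw [Function.update_of_ne hul]
      refine or_congr Iff.rfl (exists_congr fun m => and_congr_right fun hm => ?_)
      rw [hupd v m (hm.trans_le hs)]
    -- the value at `t` prescribed by the algorithm
    obtain ⟨v, hv1, hv2⟩ : ∃ v : Fin N, (¬ Paired ℓ last t u → v = u) ∧ (Paired ℓ last t u →
        v ≤ last ∧ ¬ Paired ℓ last t v ∧ ∀ k ≤ last, ¬ Paired ℓ last t k → rk v ≤ rk k) := by
      by_cases hp : Paired ℓ last t u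
      · classical
        obtain ⟨k₀, hk₀, hk₀'⟩ := exists_not_paired (ℓ := ℓ) (Nat.lt_of_succ_le ht)
        obtain ⟨v, hv, hmin⟩ := Finset.exists_min_image
          ((Finset.Iic last).filter fun k => ¬ Paired ℓ last t k) rk
          ⟨k₀, Finset.mem_filter.2 ⟨Finset.mem_Iic.2 hk₀, hk₀'⟩⟩
        rw [Finset.mem_filter, Finset.mem_Iic] at hv
        exact ⟨v, fun h => absurd hp h, fun _ => ⟨hv.1, hv.2, fun k hk hk' =>
          hmin k (Finset.mem_filter.2 ⟨Finset.mem_Iic.2 hk, hk'⟩)⟩⟩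
      · exact ⟨u, fun _ => rfl, fun h => absurd h hp⟩
    refine ⟨Function.update ℓ u v, ⟨?_, ?_, ?_, ?_⟩, ?_⟩
    · rw [Function.update_of_ne hul]
      exact h.last_le
    · rw [Function.update_of_ne hul]
      exact h.last_min
    · intro j hj hp
      rw [hpair v j j (Nat.lt_succ_iff.1 hj)] at hp
      rcases Nat.lt_succ_iff_lt_or_eq.1 hj with hj | hj
      · rw [hupd v j hj]
        exact h.unpaired j hj hp
      · obtain rfl : j = u := Fin.ext hj
        rw [Function.update_self]
        exact hv1 hp
    · intro j hj hp
      simp only [hpair v j _ (Nat.lt_succ_iff.1 hj)] at hp ⊢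
      rcases Nat.lt_succ_iff_lt_or_eq.1 hj with hj | hj
      · rw [hupd v j hj]
        exact h.paired j hj hp
      · obtain rfl : j = u := Fin.ext hj
        rw [Function.update_self]
        exact hv2 hp
    · intro j hj
      rw [Function.update_of_ne, hgt j hj]
      rintro rfl
      rw [Fin.lt_def] at hj
      exact absurd hj (not_lt.2 (Nat.le_of_succ_le ht))

end IsGreedyPairing

/-! ### The birth order -/

namespace ZigzagModule

variable {F : Type*} [Field F] {n : ℕ}

open Classical in
/-- The position of a vertex in the birth order. A vertex whose preceding arrow is forward comes
after all smaller vertices, a vertex whose preceding arrow is backward before all smaller ones. -/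
noncomputable def birthRank (M : ZigzagModule F n) (t : Fin (n + 1)) : ℤ :=
  if ∃ k : Fin n, k.succ = t ∧ M.forward k = true then (t : ℤ) else -(t : ℤ)

theorem birthRank_injective (M : ZigzagModule F n) : Function.Injective M.birthRank := by
  intro s t h
  unfold birthRank at h
  by_cases hs : ∃ k : Fin n, k.succ = s ∧ M.forward k = true <;>
  by_cases ht : ∃ k : Fin n, k.succ = t ∧ M.forward k = true <;>
  simp only [hs, ht, if_true, if_false] at h <;> ext <;> omega

theorem leB_iff (M : ZigzagModule F n) (s t : Fin (n + 1)) :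
    M.leB s t ↔ M.birthRank s ≤ M.birthRank t := by
  have main : ∀ s t : Fin (n + 1), s < t →
      ((∃ k : Fin n, k.succ = t ∧ M.forward k = true) ∧ M.birthRank s < M.birthRank t) ∨
      ((∃ k : Fin n, k.succ = t ∧ M.forward k = false) ∧
        (¬ ∃ k : Fin n, k.succ = t ∧ M.forward k = true) ∧ M.birthRank t < M.birthRank s) := by
    intro s t hst
    rw [Fin.lt_def] at hst
    by_cases ht : ∃ k : Fin n, k.succ = t ∧ M.forward k = true
    · refine Or.inl ⟨ht, ?_⟩
      unfold birthRank
      rw [if_pos ht]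
      split_ifs <;> omega
    · refine Or.inr ⟨?_, ht, ?_⟩
      · obtain ⟨k, rfl⟩ := Fin.exists_succ_eq.2 (show t ≠ 0 by rintro rfl; simp at hst)
        refine ⟨k, rfl, ?_⟩
        by_contra hk
        exact ht ⟨k, rfl, by simpa using hk⟩
      · unfold birthRank
        rw [if_neg ht]
        split_ifs <;> omega
  unfold leB
  rcases lt_trichotomy s t with h | rfl | h
  · simp only [h, h.ne, h.not_gt, true_and, false_and, or_false, false_or]
    rcases main s t h with ⟨h1, h2⟩ | ⟨-, h1, h2⟩
    · exact iff_of_true h1 h2.le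
    · exact iff_of_false h1 h2.not_ge
  · simp
  · simp only [h, h.ne', h.not_gt, true_and, false_and, false_or]
    rcases main t s h with ⟨⟨k, hk, hk'⟩, h2⟩ | ⟨h1, -, h2⟩
    · refine iff_of_false ?_ h2.not_ge
      rintro ⟨k', h3, h4⟩
      obtain rfl : k = k' := Fin.succ_injective _ (hk.trans h3.symm)
      simp [hk'] at h4
    · exact iff_of_true h1 h2.le

/-- Where all arrows are forward, the death order is the order of the vertices. -/
theorem leD_iff_of_forward (M : ZigzagModule F n) {r : Fin (n + 1)}
    (hr : ∀ k : Fin n, r ≤ k.castSucc → M.forward k = true) {s t : Fin (n + 1)}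
    (hs : r ≤ s) (ht : r ≤ t) : M.leD s t ↔ s ≤ t := by
  unfold leD
  constructor
  · rintro (rfl | ⟨h, -⟩ | ⟨h, k, rfl, hk⟩)
    · exact le_rfl
    · exact h.le
    · rw [hr k ht] at hk
      cases hk
  · intro h
    rcases h.eq_or_lt with rfl | h
    · exact Or.inl rfl
    · obtain ⟨k, rfl⟩ := Fin.exists_castSucc_eq.2 (show s ≠ Fin.last n from (h.trans_le
        (Fin.le_last t)).ne)
      exact Or.inr (Or.inl ⟨h, k, rfl, hr k hs⟩)

end ZigzagModule

/-! ### Executions of the update algorithm -/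

namespace GreedyRun

variable {F : Type*} [Field F] {n : ℕ} {M : ZigzagModule F n} {C : Type*} [AddCommGroup C]
  [Module F C] {N p : ℕ} {α : Fin N → C} {c : Fin N → F} {b d : Fin N → Fin (n + 1)}

theorem isGreedyPairing (R : GreedyRun M p α c b d) :
    IsGreedyPairing (fun j => M.birthRank (b j)) R.last R.last R.ℓ where
  last_le := R.ℓ_last_le
  last_min k hk := (M.leB_iff _ _).1 (R.ℓ_last_min k hk)
  unpaired j hj hp := (R.step_unpaired j hj hp).1
  paired j hj hp :=
    ⟨(R.step_paired j hj hp).1, (R.step_paired j hj hp).2.1, fun k hk hk' =>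
      (M.leB_iff _ _).1 ((R.step_paired j hj hp).2.2.1 k hk hk')⟩

theorem ℓ_le (R : GreedyRun M p α c b d) {j : Fin N} (hj : j ≤ R.last) : R.ℓ j ≤ R.last := by
  rcases hj.eq_or_lt with rfl | hj
  · exact R.ℓ_last_le
  · exact R.isGreedyPairing.le_last le_rfl hj

theorem ℓ_injective (R : GreedyRun M p α c b d) : Function.Injective R.ℓ := by
  have hle : ∀ j, j ≤ R.last ↔ R.ℓ j ≤ R.last := by
    intro j
    refine ⟨R.ℓ_le, fun h => ?_⟩
    by_contra hj
    rw [(R.unchanged j (not_le.1 hj)).1] at h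
    exact hj h
  intro j k h
  by_cases hj : j ≤ R.last
  · have hk : k ≤ R.last := by rwa [hle, ← h, ← hle]
    exact R.isGreedyPairing.injOn le_rfl (hj.lt_or_eq.imp id id) (hk.lt_or_eq.imp id id) h
  · have hk : ¬ k ≤ R.last := by rwa [hle, ← h, ← hle]
    rwa [(R.unchanged j (not_le.1 hj)).1, (R.unchanged k (not_le.1 hk)).1] at h

/-- What an iteration of the loop achieves: of the two cochains combined into `α' j`, the one with
index `ℓ j` has the later birth and the one with index `j` the later death. -/
theorem exists_pivot (R : GreedyRun M p α c b d)
    (hsort : ∀ j k : Fin N, j ≤ k → k ≤ R.last → M.leD (d k) (d j)) {j : Fin N}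
    (hj : j < R.last) :
    ∃ g ≤ R.last, g ≠ j ∧ M.leD (d g) (d j) ∧ R.α' j = α j - (c j / c g) • α g ∧
      ((R.ℓ j = j ∧ M.leB (b g) (b j)) ∨ (R.ℓ j = g ∧ M.leB (b j) (b g))) := by
  by_cases hp : j = R.ℓ R.last ∨ ∃ m < j, j = R.ℓ m
  · obtain ⟨h1, h2, -, h4⟩ := R.step_paired j hj hp
    refine ⟨R.ℓ j, h1, fun h => h2 (by rwa [h]), hsort _ _ ?_ h1, h4, Or.inr ⟨rfl, ?_⟩⟩
    · by_contra hlt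
      exact h2 ((R.isGreedyPairing.mono hj.le).paired_of_lt (not_le.1 hlt))
    · rw [M.leB_iff]
      exact (R.isGreedyPairing.mono hj.le).rk_le_of_paired le_rfl hp h1 h2
  · obtain ⟨h1, g, hg, hgj, hb, hd, he⟩ := R.step_unpaired j hj hp
    exact ⟨g, hg, hgj, hd, he, Or.inl ⟨h1, hb⟩⟩

/-- The choices that the algorithm asks for exist. -/
theorem nonempty_of_sorted (last : Fin N) (hlast : (last : ℕ) + 1 = p)
    (hsort : ∀ j k : Fin N, j ≤ k → k ≤ last → M.leD (d k) (d j)) :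
    Nonempty (GreedyRun M p α c b d) := by
  obtain ⟨ℓ, hℓ, hgt⟩ := IsGreedyPairing.exists_of_le (fun j => M.birthRank (b j)) last last le_rfl
  have hex : ∀ j : Fin N, ∃ j₀ : Fin N, j < last → ¬ Paired ℓ last j j →
      j₀ ≤ last ∧ j₀ ≠ j ∧ M.leB (b j₀) (b j) ∧ M.leD (d j₀) (d j) := by
    intro j
    by_cases hj : j < last
    · by_cases hp : Paired ℓ last j j
      · exact ⟨j, fun _ h => absurd hp h⟩
      · obtain ⟨m, hjm, hm, hmp⟩ := (hℓ.mono hj.le).exists_paired_ge hj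
        refine ⟨m, fun _ _ => ⟨hm, ?_, ?_, hsort j m hjm hm⟩⟩
        · rintro rfl
          exact hp hmp
        · exact (M.leB_iff _ _).2 ((hℓ.mono hj.le).rk_le_of_paired hjm hmp hj.le hp)
    · exact ⟨j, fun h => absurd h hj⟩
  choose g hg using hex
  classical
  exact ⟨{
    last := last
    last_add_one := hlast
    ℓ := ℓ
    α' := fun j => if last < j then α j else
      if Paired ℓ last j j then α j - (c j / c (ℓ j)) • α (ℓ j)
      else α j - (c j / c (g j)) • α (g j)
    ℓ_last_le := hℓ.last_le
    ℓ_last_min := fun k hk => (M.leB_iff _ _).2 (hℓ.last_min k hk)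
    step_unpaired := fun j hj hp => by
      obtain ⟨h1, h2, h3, h4⟩ := hg j hj hp
      refine ⟨hℓ.unpaired j hj hp, g j, h1, h2, h3, h4, ?_⟩
      rw [if_neg hj.not_gt]
      exact if_neg hp
    step_paired := fun j hj hp => by
      obtain ⟨h1, h2, h3⟩ := hℓ.paired j hj hp
      refine ⟨h1, h2, fun k hk hk' => (M.leB_iff _ _).2 (h3 k hk hk'), ?_⟩
      rw [if_neg hj.not_gt]
      exact if_pos hp
    unchanged := fun j hj => ⟨hgt j hj, if_pos hj⟩ }⟩

end GreedyRun

/-! ### Triangular changes of basis -/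

section Triangular

variable {F : Type*} [Field F] {V : Type*} [AddCommGroup V] [Module F V]

/-- If the `x s` with `P s` form a basis, and the family `y` (indexed through `f`) arises from it by
a change of basis that is triangular with respect to `rk`, then `y` is a basis. -/
theorem basis_of_triangular {ι κ : Type*} [Finite ι] {x : ι → V} {P : ι → Prop}
    (hli : LinearIndependent F fun s : {s // P s} => x s)
    (hsp : Submodule.span F (Set.range fun s : {s // P s} => x s) = ⊤)
    {f : ι → κ} (hf : Function.Injective f) {Q : κ → Prop} (hPQ : ∀ s, P s ↔ Q (f s))
    (hfQ : ∀ t, Q t → ∃ s, f s = t) {y : κ → V} (rk : ι → ℤ)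
    (h : ∀ s, P s → ∃ a : F, a ≠ 0 ∧
      y (f s) - a • x s ∈ Submodule.span F (x '' {t | P t ∧ rk t < rk s})) :
    LinearIndependent F (fun t : {t // Q t} => y t) ∧
      Submodule.span F (Set.range fun t : {t // Q t} => y t) = ⊤ := by
  have hmem : ∀ s, P s → x s ∈ Submodule.span F (Set.range fun t : {t // Q t} => y t) := by
    have : IsTrans ι fun s t => rk s < rk t := ⟨fun _ _ _ => lt_trans⟩
    have : Std.Irrefl fun s t : ι => rk s < rk t := ⟨fun _ => lt_irrefl _⟩
    have hwf := Finite.wellFounded_of_trans_of_irrefl fun s t : ι => rk s < rk t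
    intro s
    induction s using hwf.induction with
    | _ s ih =>
      intro hs
      obtain ⟨a, ha, hs'⟩ := h s hs
      have h1 : Submodule.span F (x '' {t | P t ∧ rk t < rk s}) ≤
          Submodule.span F (Set.range fun t : {t // Q t} => y t) := by
        rw [Submodule.span_le]
        rintro _ ⟨t, ⟨ht, hts⟩, rfl⟩
        exact ih t hts ht
      have h2 : y (f s) ∈ Submodule.span F (Set.range fun t : {t // Q t} => y t) :=
        Submodule.subset_span ⟨⟨f s, (hPQ s).1 hs⟩, rfl⟩
      have h3 := Submodule.sub_mem _ h2 (h1 hs')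
      rw [sub_sub_cancel] at h3
      exact (Submodule.smul_mem_iff _ ha).1 h3
  have hsp' : Submodule.span F (Set.range fun t : {t // Q t} => y t) = ⊤ := by
    rw [eq_top_iff, ← hsp, Submodule.span_le]
    rintro _ ⟨s, rfl⟩
    exact hmem s s.2
  refine ⟨?_, hsp'⟩
  have e : {s // P s} ≃ {t // Q t} := by
    refine Equiv.ofBijective (fun s => ⟨f s, (hPQ s).1 s.2⟩) ⟨fun s t hst => ?_, fun t => ?_⟩
    · exact Subtype.ext (hf (congrArg Subtype.val hst))
    · obtain ⟨s, hs⟩ := hfQ t t.2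
      exact ⟨⟨s, (hPQ s).2 (hs ▸ t.2)⟩, Subtype.ext hs⟩
  have := Fintype.ofFinite {s // P s}
  have := Fintype.ofEquiv _ e
  refine linearIndependent_of_top_le_span_of_card_eq_finrank hsp'.ge ?_
  rw [← Fintype.card_congr e, Module.finrank_eq_card_basis (Module.Basis.mk hli hsp.ge)]

end Triangular

namespace ZigzagModule

variable {F : Type*} [Field F] {n : ℕ}

/-! ### Representative sequences -/

namespace IsRepSeq

variable {M : ZigzagModule F n} {x y : ∀ k, M.V k} {b d b' d' : Fin (n + 1)}

theorem eq_zero (h : M.IsRepSeq x b d) {k : Fin (n + 1)} (hk : ¬ (b ≤ k ∧ k ≤ d)) : x k = 0 := by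
  by_contra hx
  exact hk ((h.ne_zero_iff k).1 hx)

theorem fmap_eq (h : M.IsRepSeq x b d) (k : Fin n) (hk : M.forward k = true)
    (hb : b ≠ k.succ) : M.fmap k hk (x k.castSucc) = x k.succ := by
  by_cases hx : x k.castSucc = 0
  · have hx' : x k.succ = 0 := by
      refine h.eq_zero fun hs => ?_
      refine (h.ne_zero_iff k.castSucc).2 ⟨?_, ?_⟩ hx
      · exact Fin.le_castSucc_iff.2 (lt_of_le_of_ne hs.1 hb)
      · exact (Fin.castSucc_lt_succ (i := k)).le.trans hs.2
    rw [hx, hx', map_zero]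
  · exact h.map_forward k hk hx

theorem bmap_eq (h : M.IsRepSeq x b d) (k : Fin n) (hk : M.forward k = false)
    (hd : d ≠ k.castSucc) : M.bmap k hk (x k.succ) = x k.castSucc := by
  by_cases hx : x k.succ = 0
  · have hx' : x k.castSucc = 0 := by
      refine h.eq_zero fun hs => ?_
      refine (h.ne_zero_iff k.succ).2 ⟨?_, ?_⟩ hx
      · exact hs.1.trans (Fin.castSucc_lt_succ (i := k)).le
      · exact Fin.castSucc_lt_iff_succ_le.1 (lt_of_le_of_ne hs.2 hd.symm)
    rw [hx, hx', map_zero]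
  · exact h.map_backward k hk hx

/-- An interval submodule may be cut off at an end of its interval where the cut arrow points
into the remaining interval. -/
theorem restrict (h : M.IsRepSeq x b d) {b' d' : Fin (n + 1)} (hbb' : b ≤ b') (hle : b' ≤ d')
    (hdd' : d' ≤ d)
    (hb : b' = b ∨ ∀ k : Fin n, k.succ = b' → M.forward k = true)
    (hd : d' = d ∨ ∀ k : Fin n, k.castSucc = d' → M.forward k = false) :
    M.IsRepSeq (fun k => if b' ≤ k ∧ k ≤ d' then x k else 0) b' d' where
  le := hle
  ne_zero_iff k := by
    split_ifs with hk
    · exact iff_of_true ((h.ne_zero_iff k).2 ⟨hbb'.trans hk.1, hk.2.trans hdd'⟩) hk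
    · exact iff_of_false (fun h => h rfl) hk
  map_forward k hk hx := by
    have hc : b' ≤ k.castSucc ∧ k.castSucc ≤ d' := by
      by_contra hc
      exact hx (if_neg hc)
    have hs : b' ≤ k.succ := hc.1.trans (Fin.castSucc_lt_succ (i := k)).le
    have hb' : b ≠ k.succ := (lt_of_le_of_lt (hbb'.trans hc.1) (Fin.castSucc_lt_succ (i := k))).ne
    rw [if_pos hc, h.fmap_eq k hk hb']
    by_cases hs' : k.succ ≤ d'
    · rw [if_pos ⟨hs, hs'⟩]
    · rw [if_neg fun h => hs' h.2]
      have he : k.castSucc = d' := le_antisymm hc.2 (Fin.le_castSucc_iff.2 (not_le.1 hs'))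
      rcases hd with rfl | hd
      · exact h.eq_zero fun h => hs' h.2
      · rw [hd k he] at hk
        cases hk
  map_backward k hk hx := by
    have hc : b' ≤ k.succ ∧ k.succ ≤ d' := by
      by_contra hc
      exact hx (if_neg hc)
    have hs : k.castSucc ≤ d' := (Fin.castSucc_lt_succ (i := k)).le.trans hc.2
    have hd' : d ≠ k.castSucc :=
      (lt_of_lt_of_le (Fin.castSucc_lt_succ (i := k)) (hc.2.trans hdd')).ne'
    rw [if_pos hc, h.bmap_eq k hk hd']
    by_cases hs' : b' ≤ k.castSucc
    · rw [if_pos ⟨hs', hs⟩]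
    · rw [if_neg fun h => hs' h.1]
      have he : k.succ = b' := le_antisymm (Fin.castSucc_lt_iff_succ_le.1 (not_le.1 hs')) hc.1
      rcases hb with rfl | hb
      · exact h.eq_zero fun h => hs' h.1
      · rw [hb k he] at hk
        cases hk

/-- A linear combination of two representative sequences, cut off below the later one (in the
birth order) of the two births and beyond the later one of the two deaths, is a representative
sequence as long as it does not vanish in between. To the right of `i`, where both sequences are
alive, all arrows point forward. -/
theorem linearCombination (hx : M.IsRepSeq x b d) (hy : M.IsRepSeq y b' d')
    {i e : Fin (n + 1)} (hi : ∀ k : Fin n, i ≤ k.castSucc → M.forward k = true)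
    (hb : M.leB b' b) (hbe : b ≤ e) (hid : i ≤ d) (hid' : i ≤ d') (hde : d ≤ e) (hde' : d' ≤ e)
    (a a' : F) (hne : ∀ k, b ≤ k → k ≤ e → a • x k + a' • y k ≠ 0) :
    M.IsRepSeq (fun k => if b ≤ k ∧ k ≤ e then a • x k + a' • y k else 0) b e where
  le := hbe
  ne_zero_iff k := by
    split_ifs with hk
    · exact iff_of_true (hne k hk.1 hk.2) hk
    · exact iff_of_false (fun h => h rfl) hk
  map_forward k hk hz := by
    have hc : b ≤ k.castSucc ∧ k.castSucc ≤ e := by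
      by_contra hc
      exact hz (if_neg hc)
    have hlt : b < k.succ := lt_of_le_of_lt hc.1 (Fin.castSucc_lt_succ (i := k))
    have hb'k : b' ≠ k.succ := by
      -- `b'` would come after `b` in the birth order
      rintro rfl
      rcases hb with h | ⟨h, -⟩ | ⟨-, k', h1, h2⟩
      · exact hlt.ne' h
      · exact hlt.not_gt h
      · rw [Fin.succ_injective _ h1, hk] at h2
        cases h2
    rw [if_pos hc, map_add, map_smul, map_smul, hx.fmap_eq k hk hlt.ne, hy.fmap_eq k hk hb'k]
    by_cases hs : k.succ ≤ e
    · rw [if_pos ⟨hlt.le, hs⟩]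
    · rw [if_neg fun h => hs h.2, hx.eq_zero fun h => hs (h.2.trans hde),
        hy.eq_zero fun h => hs (h.2.trans hde'), smul_zero, smul_zero, add_zero]
  map_backward k hk hz := by
    have hc : b ≤ k.succ ∧ k.succ ≤ e := by
      by_contra hc
      exact hz (if_neg hc)
    have hki : k.castSucc < i := by
      by_contra h
      rw [hi k (not_lt.1 h)] at hk
      cases hk
    rw [if_pos hc, map_add, map_smul, map_smul, hx.bmap_eq k hk (hki.trans_le hid).ne',
      hy.bmap_eq k hk (hki.trans_le hid').ne']
    by_cases hs : b ≤ k.castSucc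
    · rw [if_pos ⟨hs, (Fin.castSucc_lt_succ (i := k)).le.trans hc.2⟩]
    · have hbk : k.succ = b := le_antisymm (Fin.castSucc_lt_iff_succ_le.1 (not_le.1 hs)) hc.1
      have hb'k : ¬ b' ≤ k.castSucc := by
        -- `b` would have a forward arrow before it
        intro hle
        have hlt : b' < b := lt_of_le_of_lt hle (not_le.1 hs)
        rcases hb with h | ⟨-, k', h1, h2⟩ | ⟨h, -⟩
        · exact hlt.ne h
        · rw [Fin.succ_injective _ (h1.trans hbk.symm), hk] at h2
          cases h2
        · exact hlt.not_gt h
      rw [if_neg fun h => hs h.1, hx.eq_zero fun h => hs h.1, hy.eq_zero fun h => hb'k h.1,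
        smul_zero, smul_zero, add_zero]

end IsRepSeq

/-! ### Interval decompositions indexed by arbitrary types -/

/-- The representative sequences `x s`, indexed by an arbitrary type, span interval submodules of
which `M` is the internal direct sum. -/
structure IsIntervalBasis (M : ZigzagModule F n) {κ : Type*} (x : κ → ∀ k, M.V k)
    (b d : κ → Fin (n + 1)) : Prop where
  isRepSeq : ∀ s, M.IsRepSeq (x s) (b s) (d s)
  linearIndependent : ∀ k, LinearIndependent F fun s : {s // b s ≤ k ∧ k ≤ d s} => x s.1 k
  span_eq_top : ∀ k,
    Submodule.span F (Set.range fun s : {s // b s ≤ k ∧ k ≤ d s} => x s.1 k) = ⊤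

theorem IntervalDecomposition.isIntervalBasis {M : ZigzagModule F n}
    (D : M.IntervalDecomposition) : M.IsIntervalBasis D.x D.b D.d :=
  ⟨D.isRepSeq, D.linearIndependent, D.span_eq_top⟩

namespace IsIntervalBasis

variable {M : ZigzagModule F n} {κ : Type*} {x : κ → ∀ k, M.V k} {b d : κ → Fin (n + 1)}

theorem comp_equiv (h : M.IsIntervalBasis x b d) {κ' : Type*} (e : κ' ≃ κ) :
    M.IsIntervalBasis (x ∘ e) (b ∘ e) (d ∘ e) where
  isRepSeq s := h.isRepSeq (e s)
  linearIndependent k := by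
    let e' : {s // (b ∘ e) s ≤ k ∧ k ≤ (d ∘ e) s} ≃ {s // b s ≤ k ∧ k ≤ d s} :=
      e.subtypeEquiv fun _ => Iff.rfl
    exact (linearIndependent_equiv' e' rfl).2 (h.linearIndependent k)
  span_eq_top k := by
    let e' : {s // (b ∘ e) s ≤ k ∧ k ≤ (d ∘ e) s} ≃ {s // b s ≤ k ∧ k ≤ d s} :=
      e.subtypeEquiv fun _ => Iff.rfl
    rw [← h.span_eq_top k]
    congr 1
    exact e'.surjective.range_comp (fun s : {s // b s ≤ k ∧ k ≤ d s} => x s.1 k)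

theorem exists_decomposition [Finite κ] (h : M.IsIntervalBasis x b d) :
    ∃ D : M.IntervalDecomposition, ∀ t k, D.Attached k (x t k) (b t) (d t) := by
  obtain ⟨m, ⟨e⟩⟩ := Finite.exists_equiv_fin κ
  have h' := h.comp_equiv e.symm
  refine ⟨⟨m, _, _, _, h'.isRepSeq, h'.linearIndependent, h'.span_eq_top⟩, fun t k =>
    ⟨e t, ?_, ?_, ?_⟩⟩ <;> simp

theorem eq_zero_of_smul_add_smul_eq_zero (h : M.IsIntervalBasis x b d) {s t : κ} (hst : s ≠ t)
    {a a' : F} {k : Fin (n + 1)} (hs : b s ≤ k ∧ k ≤ d s) (ht : b t ≤ k ∧ k ≤ d t)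
    (h0 : a • x s k + a' • x t k = 0) : a = 0 ∧ a' = 0 := by
  have hli := (h.linearIndependent k).comp ![⟨s, hs⟩, ⟨t, ht⟩] (by
    intro p q hpq
    fin_cases p <;> fin_cases q <;> simp_all [eq_comm])
  have hli' : LinearIndependent F ![x s k, x t k] := by
    convert hli using 1
    funext p
    fin_cases p <;> rfl
  exact LinearIndependent.pair_iff.1 hli' a a' h0

theorem smul_add_smul_ne_zero (h : M.IsIntervalBasis x b d) {s t : κ} (hst : s ≠ t) {a a' : F}
    (ha : a ≠ 0) (ha' : a' ≠ 0) {k : Fin (n + 1)}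
    (hk : (b s ≤ k ∧ k ≤ d s) ∨ (b t ≤ k ∧ k ≤ d t)) : a • x s k + a' • x t k ≠ 0 := by
  by_cases hs : b s ≤ k ∧ k ≤ d s
  · by_cases ht : b t ≤ k ∧ k ≤ d t
    · exact fun h0 => ha (h.eq_zero_of_smul_add_smul_eq_zero hst hs ht h0).1
    · rw [(h.isRepSeq t).eq_zero ht, smul_zero, add_zero]
      exact smul_ne_zero ha (((h.isRepSeq s).ne_zero_iff k).2 hs)
  · rw [(h.isRepSeq s).eq_zero hs, smul_zero, zero_add]
    exact smul_ne_zero ha' (((h.isRepSeq t).ne_zero_iff k).2 (hk.resolve_left hs))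

/-- Two summands cannot be born at the target of a forward arrow whose cokernel is at most
one-dimensional. -/
theorem birth_ne_of_forward (h : M.IsIntervalBasis x b d) {s t : κ} (hst : s ≠ t) {k : Fin n}
    (hk : M.forward k = true)
    (hcoker : ∀ u v, ∃ a a' : F, (a ≠ 0 ∨ a' ≠ 0) ∧
      a • u + a' • v ∈ LinearMap.range (M.fmap k hk))
    (hs : b s = k.succ) (ht : b t = k.succ) : False := by
  have hactive : ∀ {s}, b s = k.succ → b s ≤ k.succ ∧ k.succ ≤ d s := fun {s} hs =>
    ⟨hs.le, hs ▸ (h.isRepSeq s).le⟩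
  -- the image is spanned by the summands that are born earlier
  have hrange : LinearMap.range (M.fmap k hk) ≤ Submodule.span F
      ((fun u : {u // b u ≤ k.succ ∧ k.succ ≤ d u} => x u.1 k.succ) '' {u | b u ≠ k.succ}) := by
    rw [← Submodule.map_top, ← h.span_eq_top k.castSucc, Submodule.map_span, Submodule.span_le]
    rintro _ ⟨_, ⟨u, rfl⟩, rfl⟩
    have hu : b u ≠ k.succ :=
      (lt_of_le_of_lt u.2.1 (Fin.castSucc_lt_succ (i := k))).ne
    change M.fmap k hk (x u.1 k.castSucc) ∈ Submodule.span F _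
    rw [(h.isRepSeq u).fmap_eq k hk hu]
    by_cases hu' : b u ≤ k.succ ∧ k.succ ≤ d u
    · exact Submodule.subset_span ⟨⟨u, hu'⟩, hu, rfl⟩
    · rw [(h.isRepSeq u).eq_zero hu']
      exact Submodule.zero_mem _
  have key : ∀ {s t : κ}, s ≠ t → b s = k.succ → b t = k.succ → ∀ {a a' : F},
      a • x s k.succ + a' • x t k.succ ∈ LinearMap.range (M.fmap k hk) → a = 0 := by
    intro s t hst hs ht a a' hmem
    by_contra ha
    have hnot := (h.linearIndependent k.succ).notMem_span_image
      (s := {u | b u ≠ k.succ} ∪ {⟨t, hactive ht⟩}) (x := ⟨s, hactive hs⟩) (by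
        rintro (h' | h')
        · exact h' hs
        · exact hst (congrArg Subtype.val h'))
    refine hnot ((Submodule.smul_mem_iff _ ha).1 ?_)
    have h1 : a • x s k.succ =
        (a • x s k.succ + a' • x t k.succ) - a' • x t k.succ := by abel
    change a • x s k.succ ∈ _
    rw [h1]
    refine Submodule.sub_mem _
      (Submodule.span_mono (Set.image_mono Set.subset_union_left) (hrange hmem))
      (Submodule.smul_mem _ _ (Submodule.subset_span ?_))
    exact ⟨⟨t, hactive ht⟩, Or.inr rfl, rfl⟩
  obtain ⟨a, a', ha, hmem⟩ := hcoker (x s k.succ) (x t k.succ)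
  rcases ha with ha | ha
  · exact ha (key hst hs ht hmem)
  · rw [add_comm] at hmem
    exact ha (key hst.symm ht hs hmem)

/-- Two summands cannot be born at the source of a backward arrow whose kernel is at most
one-dimensional. -/
theorem birth_ne_of_backward (h : M.IsIntervalBasis x b d) {s t : κ} (hst : s ≠ t) {k : Fin n}
    (hk : M.forward k = false)
    (hker : ∀ u v, M.bmap k hk u = 0 → M.bmap k hk v = 0 →
      ∃ a a' : F, (a ≠ 0 ∨ a' ≠ 0) ∧ a • u + a' • v = 0)
    (hs : b s = k.succ) (ht : b t = k.succ) : False := by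
  have hactive : ∀ {s}, b s = k.succ → b s ≤ k.succ ∧ k.succ ≤ d s := fun {s} hs =>
    ⟨hs.le, hs ▸ (h.isRepSeq s).le⟩
  have hzero : ∀ {s}, b s = k.succ → M.bmap k hk (x s k.succ) = 0 := fun {s} hs => by
    rw [(h.isRepSeq s).bmap_eq k hk
      (lt_of_lt_of_le (Fin.castSucc_lt_succ (i := k)) (hactive hs).2).ne']
    exact (h.isRepSeq s).eq_zero fun h' => (hs ▸ h'.1).not_gt (Fin.castSucc_lt_succ (i := k))
  obtain ⟨a, a', ha, h0⟩ := hker _ _ (hzero hs) (hzero ht)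
  have h1 := h.eq_zero_of_smul_add_smul_eq_zero hst (hactive hs) (hactive ht) h0
  exact ha.elim (fun h => h h1.1) fun h => h h1.2

/-- Two summands cannot die at the source of a forward arrow whose kernel is at most
one-dimensional. -/
theorem death_ne_of_forward (h : M.IsIntervalBasis x b d) {s t : κ} (hst : s ≠ t) {k : Fin n}
    (hk : M.forward k = true)
    (hker : ∀ u v, M.fmap k hk u = 0 → M.fmap k hk v = 0 →
      ∃ a a' : F, (a ≠ 0 ∨ a' ≠ 0) ∧ a • u + a' • v = 0)
    (hs : d s = k.castSucc) (ht : d t = k.castSucc) : False := by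
  have hactive : ∀ {s}, d s = k.castSucc → b s ≤ k.castSucc ∧ k.castSucc ≤ d s := fun {s} hs =>
    ⟨hs ▸ (h.isRepSeq s).le, hs.ge⟩
  have hzero : ∀ {s}, d s = k.castSucc → M.fmap k hk (x s k.castSucc) = 0 := fun {s} hs => by
    rw [(h.isRepSeq s).fmap_eq k hk
      (lt_of_le_of_lt (hactive hs).1 (Fin.castSucc_lt_succ (i := k))).ne]
    exact (h.isRepSeq s).eq_zero fun h' => (hs ▸ h'.2).not_gt (Fin.castSucc_lt_succ (i := k))
  obtain ⟨a, a', ha, h0⟩ := hker _ _ (hzero hs) (hzero ht)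
  have h1 := h.eq_zero_of_smul_add_smul_eq_zero hst (hactive hs) (hactive ht) h0
  exact ha.elim (fun h => h h1.1) fun h => h h1.2

end IsIntervalBasis

/-- A basis at the vertex `k` compatible with a decomposition indexes the summands that contain
`k`. -/
theorem IntervalDecomposition.IsCompatibleBasis.exists_isIntervalBasis {M : ZigzagModule F n}
    {D : M.IntervalDecomposition} {k : Fin (n + 1)} {ι : Type*} [Fintype ι] {v : ι → M.V k}
    {b d : ι → Fin (n + 1)} (h : D.IsCompatibleBasis k v b d) :
    ∃ (S : Type) (_ : Finite S) (x : ι ⊕ S → ∀ k, M.V k) (b' d' : S → Fin (n + 1)),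
      M.IsIntervalBasis x (Sum.elim b b') (Sum.elim d d') ∧ (∀ j, x (.inl j) k = v j) ∧
      ∀ s, ¬ (b' s ≤ k ∧ k ≤ d' s) := by
  choose e hev heb hed using h.attached
  have hne : ∀ j, D.b (e j) ≤ k ∧ k ≤ D.d (e j) := fun j => by
    rw [← (D.isRepSeq (e j)).ne_zero_iff k, hev]
    exact h.linearIndependent.ne_zero j
  let e' : ι → {s // D.b s ≤ k ∧ k ≤ D.d s} := fun j => ⟨e j, hne j⟩
  have he' : Function.Bijective e' := by
    rw [Fintype.bijective_iff_injective_and_card]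
    refine ⟨fun j j' hj => h.linearIndependent.injective ?_, ?_⟩
    · rw [← hev j, ← hev j', show e j = e j' from congrArg Subtype.val hj]
    · rw [← Module.finrank_eq_card_basis
        (Module.Basis.mk h.linearIndependent h.span_eq_top.ge), ← Module.finrank_eq_card_basis
        (Module.Basis.mk (D.linearIndependent k) (D.span_eq_top k).ge)]
  let E : ι ⊕ {s // ¬ (D.b s ≤ k ∧ k ≤ D.d s)} ≃ Fin D.size :=
    (Equiv.sumCongr (Equiv.ofBijective e' he') (Equiv.refl _)).trans (Equiv.sumCompl _)
  refine ⟨{s // ¬ (D.b s ≤ k ∧ k ≤ D.d s)}, inferInstance, D.x ∘ E, fun s => D.b s,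
    fun s => D.d s, ?_, hev, fun s => s.2⟩
  convert D.isIntervalBasis.comp_equiv E using 1
  · funext t
    rcases t with j | s
    · exact (heb j).symm
    · rfl
  · funext t
    rcases t with j | s
    · exact (hed j).symm
    · rfl

end ZigzagModule

namespace ZigzagModule

variable {F : Type*} [Field F] {n : ℕ}

/-! ### Submodules of zigzag modules -/

/-- An injective morphism of zigzag modules over the same quiver. -/
structure Embedding (M' M : ZigzagModule F n) where
  /-- the linear map at each vertex -/
  φ : ∀ k, M'.V k →ₗ[F] M.V k
  injective : ∀ k, Function.Injective (φ k)
  forward_eq : M'.forward = M.forward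
  φ_fmap : ∀ k (h' : M'.forward k = true) (h : M.forward k = true) v,
    φ k.succ (M'.fmap k h' v) = M.fmap k h (φ k.castSucc v)
  φ_bmap : ∀ k (h' : M'.forward k = false) (h : M.forward k = false) v,
    φ k.castSucc (M'.bmap k h' v) = M.bmap k h (φ k.succ v)

theorem Embedding.isRepSeq {M' M : ZigzagModule F n} (E : Embedding M' M) {w : ∀ k, M'.V k}
    {x : ∀ k, M.V k} (hw : ∀ k, E.φ k (w k) = x k) {b d : Fin (n + 1)}
    (h : M.IsRepSeq x b d) : M'.IsRepSeq w b d := by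
  have h0 : ∀ k, w k ≠ 0 ↔ x k ≠ 0 := fun k => by
    rw [← hw k, Ne, Ne, map_eq_zero_iff _ (E.injective k)]
  refine ⟨h.le, fun k => (h0 k).trans (h.ne_zero_iff k), fun k hk hx => ?_, fun k hk hx => ?_⟩
  · have hk' : M.forward k = true := E.forward_eq ▸ hk
    apply E.injective
    rw [E.φ_fmap k hk hk', hw, hw, h.map_forward k hk' ((h0 _).1 hx)]
  · have hk' : M.forward k = false := E.forward_eq ▸ hk
    apply E.injective
    rw [E.φ_bmap k hk hk', hw, hw, h.map_backward k hk' ((h0 _).1 hx)]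

/-! ### The update of an interval decomposition -/

/-- The linear algebra data of an update: an interval decomposition of `M` whose summands containing
`i` are indexed by `Fin N`, the others by `S`, together with the pairing `ℓ` of births with deaths,
the pivots `g j` and the coefficients `a j` with which the pivots are subtracted. -/
structure UpdateData (M : ZigzagModule F n) (l i r : Fin (n + 1)) (N : ℕ) (S : Type*) where
  /-- representative sequences -/
  x : Fin N ⊕ S → ∀ k, M.V k
  /-- births -/
  b : Fin N ⊕ S → Fin (n + 1)
  /-- deaths -/
  d : Fin N ⊕ S → Fin (n + 1)
  /-- the pairing -/
  ℓ : Equiv.Perm (Fin N)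
  /-- the index whose birth and death do not survive at `i` -/
  last : Fin N
  /-- the pivots -/
  g : Fin N → Fin N
  /-- the coefficients of the pivots -/
  a : Fin N → F
  l_lt : l < i
  lt_r : i < r
  le_or : ∀ k, k ≤ l ∨ k = i ∨ r ≤ k
  left_arrow : ∀ k : Fin n, k.castSucc = l → M.forward k = false
  right_arrow : ∀ k : Fin n, i ≤ k.castSucc → M.forward k = true
  isIntervalBasis : M.IsIntervalBasis x b d
  b_le : ∀ j, b (.inl j) ≤ l
  le_d : ∀ j, r ≤ d (.inl j)
  not_mem : ∀ s, ¬ (b (.inr s) ≤ i ∧ i ≤ d (.inr s))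
  b_injective : Function.Injective fun j => b (.inl j)
  d_injective : Function.Injective fun j => d (.inl j)
  a_last : a last = 0
  ℓ_eq : ∀ j ≠ last, a j = 0 → ℓ j = j
  pivot_ne : ∀ j, a j ≠ 0 → g j ≠ j
  d_pivot : ∀ j, a j ≠ 0 → d (.inl (g j)) ≤ d (.inl j)
  b_pivot : ∀ j, a j ≠ 0 → (ℓ j = j ∧ M.leB (b (.inl (g j))) (b (.inl j))) ∨
    (ℓ j = g j ∧ M.leB (b (.inl j)) (b (.inl (g j))))

namespace UpdateData

variable {M : ZigzagModule F n} {l i r : Fin (n + 1)} {N : ℕ} {S : Type*}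
  (U : UpdateData M l i r N S)

/-- The births of the updated sequences. The sequence with index `some last` is the part to the
right of `i` of the old sequence with index `last`, the one with index `none` the part to the left
of `i` of the old sequence with index `ℓ last`. -/
def newB : Option (Fin N) ⊕ S → Fin (n + 1)
  | .inl none => U.b (.inl (U.ℓ U.last))
  | .inl (some j) => if j = U.last then r else U.b (.inl (U.ℓ j))
  | .inr s => U.b (.inr s)

/-- The deaths of the updated sequences. -/
def newD : Option (Fin N) ⊕ S → Fin (n + 1)
  | .inl none => l
  | .inl (some j) => U.d (.inl j)
  | .inr s => U.d (.inr s)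

/-- The updated sequences before they are cut off at the ends of their intervals. -/
def comb : Option (Fin N) ⊕ S → ∀ k, M.V k
  | .inl none => U.x (.inl (U.ℓ U.last))
  | .inl (some j) => fun k => U.x (.inl j) k - U.a j • U.x (.inl (U.g j)) k
  | .inr s => U.x (.inr s)

/-- The updated sequences, as sequences in `M`. -/
noncomputable def newX (t : Option (Fin N) ⊕ S) (k : Fin (n + 1)) : M.V k :=
  if U.newB t ≤ k ∧ k ≤ U.newD t then U.comb t k else 0

theorem i_le_d (j : Fin N) : i ≤ U.d (.inl j) := U.lt_r.le.trans (U.le_d j)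

theorem b_le_i (j : Fin N) : U.b (.inl j) ≤ i := (U.b_le j).trans U.l_lt.le

theorem isRepSeq_newX (t : Option (Fin N) ⊕ S) :
    M.IsRepSeq (U.newX t) (U.newB t) (U.newD t) := by
  have hx := U.isIntervalBasis.isRepSeq
  rcases t with (_ | j) | s
  · exact (hx (.inl (U.ℓ U.last))).restrict le_rfl (U.b_le _)
      (U.l_lt.le.trans (U.i_le_d _)) (Or.inl rfl) (Or.inr U.left_arrow)
  · by_cases hj : j = U.last
    · subst hj
      have hb : U.newB (.inl (some U.last)) = r := if_pos rfl
      have hc : U.comb (.inl (some U.last)) = U.x (.inl U.last) := by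
        funext k
        simp [comb, U.a_last]
      have h := (hx (.inl U.last)).restrict ((U.b_le_i _).trans U.lt_r.le)
        (U.le_d _) le_rfl (Or.inr fun k hk => U.right_arrow k
          (Fin.le_castSucc_iff.2 (hk ▸ U.lt_r))) (Or.inl rfl)
      unfold newX
      rw [hb, hc]
      exact h
    · have hb : U.newB (.inl (some j)) = U.b (.inl (U.ℓ j)) := if_neg hj
      unfold newX
      rw [hb]
      change M.IsRepSeq (fun k => if U.b (.inl (U.ℓ j)) ≤ k ∧ k ≤ U.d (.inl j) then
        U.x (.inl j) k - U.a j • U.x (.inl (U.g j)) k else 0) (U.b (.inl (U.ℓ j))) (U.d (.inl j))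
      have hle : U.b (.inl (U.ℓ j)) ≤ U.d (.inl j) := (U.b_le_i _).trans (U.i_le_d _)
      by_cases ha : U.a j = 0
      · rw [U.ℓ_eq j hj ha, ha]
        convert (hx (.inl j)).restrict le_rfl (hx (.inl j)).le le_rfl (Or.inl rfl) (Or.inl rfl)
          using 4
        rw [zero_smul, sub_zero]
      · have hgj : (Sum.inl (U.g j) : Fin N ⊕ S) ≠ .inl j :=
          fun h => U.pivot_ne j ha (Sum.inl_injective h)
        -- to the left of `i` the summand `ℓ j` is alive, to the right of it the summand `j`
        have hactive : ∀ k, U.b (.inl (U.ℓ j)) ≤ k → k ≤ U.d (.inl j) →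
            (U.b (.inl (U.ℓ j)) ≤ k ∧ k ≤ U.d (.inl (U.ℓ j))) ∨
            (U.b (.inl j) ≤ k ∧ k ≤ U.d (.inl j)) := by
          intro k h1 h2
          rcases le_total k i with h | h
          · exact Or.inl ⟨h1, h.trans (U.i_le_d _)⟩
          · exact Or.inr ⟨(U.b_le_i _).trans h, h2⟩
        rcases U.b_pivot j ha with ⟨hℓ, hb⟩ | ⟨hℓ, hb⟩
        · rw [hℓ] at hactive hle ⊢
          convert (hx (.inl j)).linearCombination (hx (.inl (U.g j))) U.right_arrow hb hle
            (U.i_le_d _) (U.i_le_d _) le_rfl (U.d_pivot j ha) 1 (-U.a j) (fun k h1 h2 =>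
              U.isIntervalBasis.smul_add_smul_ne_zero hgj.symm one_ne_zero (neg_ne_zero.2 ha)
                (Or.inl ⟨h1, h2⟩)) using 4
          rw [one_smul, neg_smul, sub_eq_add_neg]
        · rw [hℓ] at hactive hle ⊢
          convert (hx (.inl (U.g j))).linearCombination (hx (.inl j)) U.right_arrow hb hle
            (U.i_le_d _) (U.i_le_d _) (U.d_pivot j ha) le_rfl (-U.a j) 1 (fun k h1 h2 =>
              U.isIntervalBasis.smul_add_smul_ne_zero hgj (neg_ne_zero.2 ha) one_ne_zero
                (hactive k h1 h2)) using 4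
          rw [one_smul, neg_smul, add_comm, sub_eq_add_neg]
  · exact (hx (.inr s)).restrict le_rfl (hx (.inr s)).le le_rfl (Or.inl rfl) (Or.inl rfl)

theorem x_mem_span {s : Fin N ⊕ S} (k : Fin (n + 1)) {p : Fin N ⊕ S → Prop} (hs : p s) :
    U.x s k ∈ Submodule.span F ((fun t => U.x t k) '' {t | (U.b t ≤ k ∧ k ≤ U.d t) ∧ p t}) := by
  by_cases h : U.b s ≤ k ∧ k ≤ U.d s
  · exact Submodule.subset_span ⟨s, ⟨h, hs⟩, rfl⟩
  · rw [(U.isIntervalBasis.isRepSeq s).eq_zero h]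
    exact Submodule.zero_mem _

/-- Sorted by death, the change of basis to the right of `i` is triangular. -/
theorem comb_sub_mem_right (j : Fin N) (k : Fin (n + 1)) :
    U.comb (.inl (some j)) k - (1 : F) • U.x (.inl j) k ∈
      Submodule.span F ((fun t => U.x t k) '' {t | (U.b t ≤ k ∧ k ≤ U.d t) ∧
        (((U.d t : Fin (n + 1)) : ℕ) : ℤ) < ((U.d (.inl j) : Fin (n + 1)) : ℕ)}) := by
  have he : U.comb (.inl (some j)) k - (1 : F) • U.x (.inl j) k =
      (-U.a j) • U.x (.inl (U.g j)) k := by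
    simp only [comb]
    module
  rw [he]
  by_cases ha : U.a j = 0
  · rw [ha, neg_zero, zero_smul]
    exact Submodule.zero_mem _
  · refine Submodule.smul_mem _ _ (U.x_mem_span k ?_)
    have := lt_of_le_of_ne (U.d_pivot j ha) (U.d_injective.ne (U.pivot_ne j ha))
    exact_mod_cast this

/-- Sorted by birth, the change of basis to the left of `i` is triangular. -/
theorem comb_sub_mem_left {j : Fin N} (hj : j ≠ U.last) (k : Fin (n + 1)) :
    ∃ a : F, a ≠ 0 ∧ U.comb (.inl (some j)) k - a • U.x (.inl (U.ℓ j)) k ∈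
      Submodule.span F ((fun t => U.x t k) '' {t | (U.b t ≤ k ∧ k ≤ U.d t) ∧
        M.birthRank (U.b t) < M.birthRank (U.b (.inl (U.ℓ j)))}) := by
  by_cases ha : U.a j = 0
  · refine ⟨1, one_ne_zero, ?_⟩
    rw [U.ℓ_eq j hj ha]
    simp [comb, ha]
  · have hlt : ∀ s t : Fin N, s ≠ t → M.leB (U.b (.inl s)) (U.b (.inl t)) →
        M.birthRank (U.b (.inl s)) < M.birthRank (U.b (.inl t)) := fun s t hst h =>
      lt_of_le_of_ne ((M.leB_iff _ _).1 h)
        (M.birthRank_injective.ne (U.b_injective.ne hst))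
    rcases U.b_pivot j ha with ⟨hℓ, hb⟩ | ⟨hℓ, hb⟩
    · refine ⟨1, one_ne_zero, ?_⟩
      have he : U.comb (.inl (some j)) k - (1 : F) • U.x (.inl j) k =
          (-U.a j) • U.x (.inl (U.g j)) k := by
        simp only [comb]
        module
      rw [hℓ, he]
      exact Submodule.smul_mem _ _ (U.x_mem_span k (hlt _ _ (U.pivot_ne j ha) hb))
    · refine ⟨-U.a j, neg_ne_zero.2 ha, ?_⟩
      have he : U.comb (.inl (some j)) k - (-U.a j) • U.x (.inl (U.g j)) k =
          U.x (.inl j) k := by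
        simp only [comb]
        module
      rw [hℓ, he]
      exact U.x_mem_span k (hlt _ _ (U.pivot_ne j ha).symm hb)

theorem basis_right [Finite S] {k : Fin (n + 1)} (hk : r ≤ k) :
    LinearIndependent F (fun t : {t // U.newB t ≤ k ∧ k ≤ U.newD t} => U.newX t k) ∧
      Submodule.span F
        (Set.range fun t : {t // U.newB t ≤ k ∧ k ≤ U.newD t} => U.newX t k) = ⊤ := by
  have hPQ : ∀ s : Fin N ⊕ S, (U.b s ≤ k ∧ k ≤ U.d s) ↔
      (U.newB (Sum.map some id s) ≤ k ∧ k ≤ U.newD (Sum.map some id s)) := by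
    rintro (j | s)
    · have h1 : U.b (.inl j) ≤ k := (U.b_le_i j).trans (U.lt_r.le.trans hk)
      have h2 : U.newB (.inl (some j)) ≤ k := by
        simp only [newB]
        split_ifs
        · exact hk
        · exact (U.b_le_i _).trans (U.lt_r.le.trans hk)
      exact and_congr_left' (iff_of_true h1 h2)
    · exact Iff.rfl
  refine basis_of_triangular (U.isIntervalBasis.linearIndependent k)
    (U.isIntervalBasis.span_eq_top k) (x := fun s => U.x s k) (y := fun t => U.newX t k)
    (f := Sum.map some id)
    ((Option.some_injective _).sumMap Function.injective_id) hPQ ?_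
    (fun s => ((U.d s : Fin (n + 1)) : ℕ)) ?_
  · rintro ((_ | j) | s) ht
    · exact absurd (ht.2.trans_lt U.l_lt) (U.lt_r.le.trans hk).not_gt
    · exact ⟨.inl j, rfl⟩
    · exact ⟨.inr s, rfl⟩
  · intro s hs
    refine ⟨1, one_ne_zero, ?_⟩
    have hX : U.newX (Sum.map some id s) k = U.comb (Sum.map some id s) k :=
      if_pos ((hPQ s).1 hs)
    rw [hX]
    rcases s with j | s
    · exact U.comb_sub_mem_right j k
    · simp [comb]

theorem basis_left [Finite S] {k : Fin (n + 1)} (hk : k ≤ l) :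
    LinearIndependent F (fun t : {t // U.newB t ≤ k ∧ k ≤ U.newD t} => U.newX t k) ∧
      Submodule.span F
        (Set.range fun t : {t // U.newB t ≤ k ∧ k ≤ U.newD t} => U.newX t k) = ⊤ := by
  -- the updated sequence that has the birth with index `m`
  let e : Fin N → Option (Fin N) := fun m =>
    if U.ℓ.symm m = U.last then none else some (U.ℓ.symm m)
  have heℓ : ∀ j, e (U.ℓ j) = if j = U.last then none else some j := fun j => by
    simp only [e, Equiv.symm_apply_apply]
  have he : Function.Injective e := by
    intro m m' h
    obtain ⟨j, rfl⟩ := U.ℓ.surjective m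
    obtain ⟨j', rfl⟩ := U.ℓ.surjective m'
    rw [heℓ, heℓ] at h
    by_cases hj : j = U.last <;> by_cases hj' : j' = U.last <;> simp_all
  have hki : k ≤ i := hk.trans U.l_lt.le
  have hPQ : ∀ s : Fin N ⊕ S, (U.b s ≤ k ∧ k ≤ U.d s) ↔
      (U.newB (Sum.map e id s) ≤ k ∧ k ≤ U.newD (Sum.map e id s)) := by
    rintro (m | s)
    · obtain ⟨j, rfl⟩ := U.ℓ.surjective m
      rw [Sum.map_inl, heℓ]
      by_cases hj : j = U.last
      · rw [if_pos hj, hj]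
        exact and_congr_right' (iff_of_true (hki.trans (U.i_le_d _)) hk)
      · rw [if_neg hj]
        have hb : U.newB (.inl (some j)) = U.b (.inl (U.ℓ j)) := if_neg hj
        rw [hb]
        exact and_congr_right' (iff_of_true (hki.trans (U.i_le_d _)) (hki.trans (U.i_le_d _)))
    · exact Iff.rfl
  refine basis_of_triangular (U.isIntervalBasis.linearIndependent k)
    (U.isIntervalBasis.span_eq_top k) (x := fun s => U.x s k) (y := fun t => U.newX t k)
    (f := Sum.map e id)
    (he.sumMap Function.injective_id) hPQ ?_ (fun s => M.birthRank (U.b s)) ?_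
  · rintro ((_ | j) | s) ht
    · exact ⟨.inl (U.ℓ U.last), by rw [Sum.map_inl, heℓ, if_pos rfl]⟩
    · refine ⟨.inl (U.ℓ j), ?_⟩
      have hj : j ≠ U.last := by
        rintro rfl
        have hb : U.newB (.inl (some U.last)) = r := if_pos rfl
        rw [hb] at ht
        exact absurd (ht.1.trans hki) U.lt_r.not_ge
      rw [Sum.map_inl, heℓ, if_neg hj]
    · exact ⟨.inr s, rfl⟩
  · intro s hs
    have hX : U.newX (Sum.map e id s) k = U.comb (Sum.map e id s) k := if_pos ((hPQ s).1 hs)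
    rw [hX]
    rcases s with m | s
    · obtain ⟨j, rfl⟩ := U.ℓ.surjective m
      rw [Sum.map_inl, heℓ]
      by_cases hj : j = U.last
      · refine ⟨1, one_ne_zero, ?_⟩
        rw [if_pos hj, hj]
        simp [comb]
      · rw [if_neg hj]
        exact U.comb_sub_mem_left hj k
    · exact ⟨1, one_ne_zero, by simp [comb]⟩

theorem linearIndependent_comb [Finite S] :
    LinearIndependent F fun j => U.comb (.inl (some j)) i := by
  have hb := (basis_of_triangular (U.isIntervalBasis.linearIndependent i)
    (U.isIntervalBasis.span_eq_top i) (x := fun s => U.x s i)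
    (y := Sum.elim (fun j => U.comb (.inl (some j)) i) fun s => U.x (.inr s) i)
    (f := id) Function.injective_id (Q := fun s => U.b s ≤ i ∧ i ≤ U.d s)
    (fun _ => Iff.rfl) (fun t _ => ⟨t, rfl⟩)
    (fun s => ((U.d s : Fin (n + 1)) : ℕ)) (by
      rintro (j | s) hs
      · exact ⟨1, one_ne_zero, U.comb_sub_mem_right j i⟩
      · exact absurd hs (U.not_mem s))).1
  exact hb.comp (fun j => ⟨.inl j, U.b_le_i j, U.i_le_d j⟩) fun j j' h =>
    Sum.inl_injective (congrArg Subtype.val h)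

theorem newX_i {j : Fin N} (hj : j ≠ U.last) :
    U.newX (.inl (some j)) i = U.comb (.inl (some j)) i := by
  refine if_pos ⟨?_, U.i_le_d j⟩
  have hb : U.newB (.inl (some j)) = U.b (.inl (U.ℓ j)) := if_neg hj
  exact hb ▸ U.b_le_i _

/-- The indices of the updated sequences that contain `i`. -/
theorem mem_i_iff (t : Option (Fin N) ⊕ S) :
    (U.newB t ≤ i ∧ i ≤ U.newD t) ↔ ∃ j ≠ U.last, t = .inl (some j) := by
  rcases t with (_ | j) | s
  · refine iff_of_false (fun h => U.l_lt.not_ge h.2) ?_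
    rintro ⟨j, -, h⟩
    cases h
  · by_cases hj : j = U.last
    · have hb : U.newB (.inl (some j)) = r := if_pos hj
      rw [hb]
      refine iff_of_false (fun h => U.lt_r.not_ge h.1) ?_
      rintro ⟨j', h, h'⟩
      cases h'
      exact h hj
    · have hb : U.newB (.inl (some j)) = U.b (.inl (U.ℓ j)) := if_neg hj
      rw [hb]
      exact iff_of_true ⟨U.b_le_i _, U.i_le_d j⟩ ⟨j, hj, rfl⟩
  · refine iff_of_false (U.not_mem s) ?_
    rintro ⟨j, -, h⟩
    cases h

/-- The updated sequences decompose every submodule `M'` of `M` that agrees with `M` away from `i`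
and is contained in a hyperplane at `i`. -/
theorem exists_decomposition [Finite S] {M' : ZigzagModule F n} (E : Embedding M' M)
    (hsurj : ∀ k ≠ i, Function.Surjective (E.φ k)) {c : M.V i →ₗ[F] F} (hc : c ≠ 0)
    (hcφ : ∀ v, c (E.φ i v) = 0) {w : {j // j ≠ U.last} → M'.V i}
    (hw : ∀ j, E.φ i (w j) = U.comb (.inl (some j.1)) i) :
    ∃ D : M'.IntervalDecomposition,
      D.IsCompatibleBasis i w (fun j => U.b (.inl (U.ℓ j))) (fun j => U.d (.inl j)) ∧
      (∀ v, E.φ l v = U.x (.inl (U.ℓ U.last)) l →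
        D.Attached l v (U.b (.inl (U.ℓ U.last))) l) ∧
      (∀ v, E.φ r v = U.x (.inl U.last) r → D.Attached r v r (U.d (.inl U.last))) := by
  have hli : LinearIndependent F w := by
    refine LinearIndependent.of_comp (E.φ i) ?_
    have he : (E.φ i ∘ w) =
        fun j : {j // j ≠ U.last} => U.comb (.inl (some j.1)) i := funext hw
    rw [he]
    exact U.linearIndependent_comb.comp _ Subtype.val_injective
  have hsp : Submodule.span F (Set.range w) = ⊤ := by
    refine hli.span_eq_top_of_card_eq_finrank' (le_antisymm hli.fintype_card_le_finrank ?_)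
    have h1 : Module.finrank F (M'.V i) = Module.finrank F (LinearMap.range (E.φ i)) :=
      (LinearMap.finrank_range_of_inj (E.injective i)).symm
    have h2 : LinearMap.range (E.φ i) ≤ LinearMap.ker c := by
      rintro _ ⟨v, rfl⟩
      exact hcφ v
    have h3 : Module.finrank F (LinearMap.ker c) < Module.finrank F (M.V i) :=
      Submodule.finrank_lt fun h => hc (LinearMap.ker_eq_top.1 h)
    have h4 : Module.finrank F (M.V i) ≤ N := by
      let e : Fin N → {s : Fin N ⊕ S // U.b s ≤ i ∧ i ≤ U.d s} :=
        fun j => ⟨.inl j, U.b_le_i j, U.i_le_d j⟩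
      have he : Function.Surjective e := by
        rintro ⟨j | s, hs⟩
        · exact ⟨j, rfl⟩
        · exact absurd hs (U.not_mem s)
      have h5 : Submodule.span F (Set.range fun j : Fin N => U.x (.inl j) i) = ⊤ := by
        rw [← U.isIntervalBasis.span_eq_top i, ← he.range_comp]
        rfl
      have h6 := finrank_range_le_card (R := F) fun j : Fin N => U.x (.inl j) i
      rwa [Set.finrank, h5, finrank_top, Fintype.card_fin] at h6
    have h5 : Fintype.card {j // j ≠ U.last} = N - 1 := by
      rw [Fintype.card_subtype_compl, Fintype.card_fin, Fintype.card_subtype_eq]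
    have h6 := Submodule.finrank_mono h2
    omega
  have hex : ∀ t k, ∃ v, E.φ k v = U.newX t k := by
    intro t k
    by_cases hk : k = i
    · subst hk
      by_cases ht : U.newB t ≤ k ∧ k ≤ U.newD t
      · obtain ⟨j, hj, rfl⟩ := (U.mem_i_iff t).1 ht
        exact ⟨w ⟨j, hj⟩, by rw [hw, U.newX_i hj]⟩
      · exact ⟨0, by rw [map_zero, newX, if_neg ht]⟩
    · exact hsurj k hk _
  choose W hW using hex
  have hWi : ∀ j : {j // j ≠ U.last}, W (.inl (some j.1)) i = w j := fun j =>
    E.injective i (by rw [hW, U.newX_i j.2, hw])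
  let e : {j // j ≠ U.last} ≃ {t // U.newB t ≤ i ∧ i ≤ U.newD t} :=
    Equiv.ofBijective (fun j => ⟨.inl (some j), (U.mem_i_iff _).2 ⟨j, j.2, rfl⟩⟩) (by
      refine ⟨fun j j' h => ?_, fun t => ?_⟩
      · exact Subtype.ext (Option.some_injective _ (Sum.inl_injective (congrArg Subtype.val h)))
      · obtain ⟨j, hj, h⟩ := (U.mem_i_iff t).1 t.2
        exact ⟨⟨j, hj⟩, Subtype.ext h.symm⟩)
  have he : (fun t : {t // U.newB t ≤ i ∧ i ≤ U.newD t} => W t i) ∘ e = w := funext hWi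
  have hne : ∀ k, k ≠ i →
      LinearIndependent F (fun t : {t // U.newB t ≤ k ∧ k ≤ U.newD t} => U.newX t k) ∧
      Submodule.span F
        (Set.range fun t : {t // U.newB t ≤ k ∧ k ≤ U.newD t} => U.newX t k) = ⊤ := by
    intro k hk
    rcases U.le_or k with h | h | h
    · exact U.basis_left h
    · exact absurd h hk
    · exact U.basis_right h
  have hφW : ∀ k, (E.φ k ∘ fun t : {t // U.newB t ≤ k ∧ k ≤ U.newD t} => W t k) =
      fun t : {t // U.newB t ≤ k ∧ k ≤ U.newD t} => U.newX t k :=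
    fun k => funext fun t => hW t k
  have hbasis : M'.IsIntervalBasis W U.newB U.newD := by
    refine ⟨fun t => E.isRepSeq (hW t) (U.isRepSeq_newX t), fun k => ?_, fun k => ?_⟩
    · by_cases hk : k = i
      · subst hk
        rwa [← linearIndependent_equiv e, he]
      · refine LinearIndependent.of_comp (E.φ k) ?_
        rw [hφW]
        exact (hne k hk).1
    · by_cases hk : k = i
      · subst hk
        rw [← e.surjective.range_comp, he, hsp]
      · apply Submodule.map_injective_of_injective (E.injective k)
        rw [Submodule.map_span, ← Set.range_comp, hφW, (hne k hk).2, Submodule.map_top,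
          LinearMap.range_eq_top.2 (hsurj k hk)]
  obtain ⟨D, hD⟩ := hbasis.exists_decomposition
  refine ⟨D, ⟨hli, hsp, fun j => ?_⟩, fun v hv => ?_, fun v hv => ?_⟩
  · have h := hD (.inl (some j)) i
    rw [hWi] at h
    have hb : U.newB (.inl (some j.1)) = U.b (.inl (U.ℓ j)) := if_neg j.2
    rwa [hb] at h
  · have h := hD (.inl none) l
    have hX : U.newX (.inl none) l = U.x (.inl (U.ℓ U.last)) l := if_pos ⟨U.b_le _, le_rfl⟩
    rwa [E.injective l ((hW _ _).trans (hX.trans hv.symm))] at h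
  · have h := hD (.inl (some U.last)) r
    have hb : U.newB (.inl (some U.last)) = r := if_pos rfl
    have hX : U.newX (.inl (some U.last)) r = U.x (.inl U.last) r := by
      rw [newX, if_pos ⟨hb.le, U.le_d _⟩]
      simp [comb, U.a_last]
    rw [E.injective r ((hW _ _).trans (hX.trans hv.symm)), hb] at h
    exact h

end UpdateData

end ZigzagModule

/-! ### Cohomology and the insertion of a simplex -/

section Extension

variable {F : Type*} [Field F] {X : Type*}

theorem cochainRes_extend {K L : PreAbstractSimplicialComplex X} (h : K ≤ L) (α : Cochain F K) :
    cochainRes F h (α.extend L) = α :=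
  funext fun τ => dif_pos τ.2

/-- Extension by zero as a linear map. -/
noncomputable def extendLinear (F : Type*) [Field F] (K L : PreAbstractSimplicialComplex X) :
    Cochain F K →ₗ[F] Cochain F L where
  toFun α := α.extend L
  map_add' α β := by
    funext τ
    simp only [Cochain.extend, Pi.add_apply]
    split_ifs <;> simp
  map_smul' a α := by
    funext τ
    simp only [Cochain.extend, Pi.smul_apply, RingHom.id_apply]
    split_ifs <;> simp

theorem cochainRes_extend_of_le {K K' L : PreAbstractSimplicialComplex X} (h : K' ≤ K)
    (h' : K' ≤ L) (α : Cochain F K) : cochainRes F h' (α.extend L) = cochainRes F h α :=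
  funext fun τ => dif_pos (h τ.2)

end Extension

section InsertSimplex

variable {F : Type*} [Field F] {X : Type*} [LinearOrder X]

theorem cohClass_eq_zero_iff {K : PreAbstractSimplicialComplex X} {α : Cochain F K}
    (h : coboundary F K α = 0) : cohClass α h = 0 ↔ ∃ γ, coboundary F K γ = α :=
  (Submodule.Quotient.mk_eq_zero _).trans Iff.rfl

theorem exists_cohClass_eq {K : PreAbstractSimplicialComplex X} (v : Cohomology F K) :
    ∃ α h, cohClass (F := F) (K := K) α h = v := by
  obtain ⟨⟨α, h⟩, rfl⟩ := Submodule.Quotient.mk_surjective _ v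
  exact ⟨α, h, rfl⟩

theorem cohomologyMap_cohClass {K L : PreAbstractSimplicialComplex X} (h : K ≤ L)
    {α : Cochain F L} (hα : coboundary F L α = 0) {β : Cochain F K}
    (hβ : coboundary F K β = 0) (hαβ : cochainRes F h α = β) :
    cohomologyMap F h (cohClass α hα) = cohClass β hβ := by
  subst hαβ
  rfl

theorem cohomologyMap_comp {K L P : PreAbstractSimplicialComplex X} (h : K ≤ L) (h' : L ≤ P)
    (v : Cohomology F P) :
    cohomologyMap F h (cohomologyMap F h' v) = cohomologyMap F (h.trans h') v := by
  obtain ⟨α, hα, rfl⟩ := exists_cohClass_eq v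
  rfl

theorem cohomologyMap_bijective_of_eq {K L : PreAbstractSimplicialComplex X} (h : K ≤ L)
    (he : K = L) : Function.Bijective (cohomologyMap F h) := by
  subst he
  have hid : cohomologyMap F h = LinearMap.id := by
    ext v
    rfl
  rw [hid]
  exact Function.bijective_id

theorem coboundary_extend_of_eq {K L : PreAbstractSimplicialComplex X} (h : K = L)
    {α : Cochain F K} (hα : coboundary F K α = 0) : coboundary F L (α.extend L) = 0 := by
  subst h
  have he : α.extend K = α := cochainRes_extend le_rfl α
  rw [he, hα]

/-- Removing first `v` and then `w` from `τ` has the opposite sign of removing first `w` and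
then `v`. -/
theorem sign_erase_erase {τ : Finset X} {v w : X} (hv : v ∈ τ) (hvw : v < w) :
    (-1 : F) ^ (τ.filter (· < v)).card * (-1) ^ ((τ.erase v).filter (· < w)).card =
      -((-1) ^ (τ.filter (· < w)).card * (-1) ^ ((τ.erase w).filter (· < v)).card) := by
  have h1 : (τ.erase w).filter (· < v) = τ.filter (· < v) := by
    ext u
    simp only [Finset.mem_filter, Finset.mem_erase]
    exact ⟨fun h => ⟨h.1.2, h.2⟩, fun h => ⟨⟨(h.2.trans hvw).ne, h.1⟩, h.2⟩⟩
  have h2 : ((τ.erase v).filter (· < w)).card + 1 = (τ.filter (· < w)).card := by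
    rw [Finset.filter_erase]
    exact Finset.card_erase_add_one (Finset.mem_filter.2 ⟨hv, hvw⟩)
  rw [h1, ← h2, pow_succ]
  ring

/-- The coboundary of a coboundary vanishes. -/
theorem coboundary_coboundary (K : PreAbstractSimplicialComplex X) (α : Cochain F K) :
    coboundary F K (coboundary F K α) = 0 := by
  classical
  funext τ
  -- the value of `α` at a finite set, `0` if it is not a face
  let A : Finset X → F := fun ρ => if h : ρ ∈ K.faces then α ⟨ρ, h⟩ else 0
  have h1 : coboundary F K (coboundary F K α) τ = ∑ v ∈ τ.1, ∑ w ∈ τ.1.erase v,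
      (-1 : F) ^ (τ.1.filter (· < v)).card * (-1) ^ ((τ.1.erase v).filter (· < w)).card *
        A ((τ.1.erase v).erase w) := by
    refine Finset.sum_congr rfl fun v _ => ?_
    by_cases hv : τ.1.erase v ∈ K.faces
    · rw [dif_pos hv]
      simp only [coboundary, LinearMap.coe_mk, AddHom.coe_mk, Finset.mul_sum, mul_assoc, A]
    · rw [dif_neg hv, mul_zero]
      have he : τ.1.erase v = ∅ := by
        by_contra hne
        exact hv ((K.isRelLowerSet_faces τ.2).2 (Finset.erase_subset _ _)
          (Finset.nonempty_iff_ne_empty.2 hne))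
      rw [he, Finset.sum_empty]
  rw [h1, Finset.sum_sigma']
  refine Finset.sum_involution (fun p _ => ⟨p.2, p.1⟩) ?_ ?_ ?_ ?_
  · rintro ⟨v, w⟩ h
    simp only [Finset.mem_sigma, Finset.mem_erase] at h
    obtain ⟨hv, hwv, hw⟩ := h
    simp only
    rw [Finset.erase_right_comm (a := w) (b := v), ← add_mul]
    rcases lt_or_gt_of_ne hwv with hlt | hlt
    · rw [sign_erase_erase hw hlt, add_neg_cancel, zero_mul]
    · rw [sign_erase_erase hv hlt, neg_add_cancel, zero_mul]
  · rintro ⟨v, w⟩ h _ he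
    simp only [Finset.mem_sigma, Finset.mem_erase] at h
    exact h.2.1 (congrArg Sigma.fst he)
  · rintro ⟨v, w⟩ h
    simp only [Finset.mem_sigma, Finset.mem_erase] at h ⊢
    exact ⟨h.2.2, h.2.1.symm, h.1⟩
  · rintro ⟨v, w⟩ _
    rfl

namespace InsertSimplex

variable {K L : PreAbstractSimplicialComplex X} {σ : Finset X}

theorem le (h : InsertSimplex K L σ) : K ≤ L := by
  intro τ hτ
  rw [h.2]
  exact Set.mem_insert_of_mem _ hτ

theorem mem (h : InsertSimplex K L σ) : σ ∈ L.faces := by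
  rw [h.2]
  exact Set.mem_insert _ _

theorem ext_cochain (h : InsertSimplex K L σ) {α β : Cochain F L}
    (hK : cochainRes F h.le α = cochainRes F h.le β)
    (hσ : α ⟨σ, h.mem⟩ = β ⟨σ, h.mem⟩) : α = β := by
  funext ⟨τ, hτ⟩
  by_cases hτσ : τ = σ
  · subst hτσ
    exact hσ
  · have hτK : τ ∈ K.faces := by
      have hτ' := hτ
      rw [h.2] at hτ'
      exact hτ'.resolve_left hτσ
    exact congrFun hK ⟨τ, hτK⟩

/-- The linear form `α ↦ α(∂ σ)`. -/
noncomputable def evalBoundary (F : Type*) [Field F] (h : InsertSimplex K L σ) :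
    Cochain F K →ₗ[F] F :=
  LinearMap.proj (R := F) (φ := fun _ : L.faces => F) ⟨σ, h.mem⟩ ∘ₗ
    coboundary F L ∘ₗ extendLinear F K L

/-- The value of `δ α` at a simplex depends only on the values of `α` at smaller simplices. -/
theorem coboundary_apply_self (h : InsertSimplex K L σ) (α : Cochain F L) :
    coboundary F L α ⟨σ, h.mem⟩ = h.evalBoundary F (cochainRes F h.le α) := by
  change coboundary F L α ⟨σ, h.mem⟩ =
    coboundary F L ((cochainRes F h.le α).extend L) ⟨σ, h.mem⟩
  simp only [coboundary, LinearMap.coe_mk, AddHom.coe_mk]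
  refine Finset.sum_congr rfl fun v hv => ?_
  congr 1
  by_cases hL : σ.erase v ∈ L.faces
  · rw [dif_pos hL, dif_pos hL]
    have hK : σ.erase v ∈ K.faces := by
      have hL' := hL
      rw [h.2] at hL'
      refine hL'.resolve_left fun he => ?_
      rw [← he] at hv
      exact Finset.notMem_erase _ _ hv
    exact (congrFun (cochainRes_extend h.le (cochainRes F h.le α)) ⟨σ.erase v, hK⟩).symm
  · rw [dif_neg hL, dif_neg hL]

theorem coboundary_eq_zero_iff (h : InsertSimplex K L σ) {α : Cochain F L} :
    coboundary F L α = 0 ↔ coboundary F K (cochainRes F h.le α) = 0 ∧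
      h.evalBoundary F (cochainRes F h.le α) = 0 := by
  rw [← h.coboundary_apply_self, coboundary_cochainRes]
  constructor
  · intro h0
    rw [h0]
    exact ⟨map_zero _, rfl⟩
  · rintro ⟨h1, h2⟩
    exact h.ext_cochain (by rw [h1, map_zero]) h2

theorem coboundary_extend_eq_zero_iff (h : InsertSimplex K L σ) {α : Cochain F K} :
    coboundary F L (α.extend L) = 0 ↔ coboundary F K α = 0 ∧ h.evalBoundary F α = 0 := by
  rw [h.coboundary_eq_zero_iff, cochainRes_extend]

theorem evalBoundary_coboundary (h : InsertSimplex K L σ) (γ : Cochain F K) :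
    h.evalBoundary F (coboundary F K γ) = 0 := by
  have h1 : coboundary F K γ = cochainRes F h.le (coboundary F L (γ.extend L)) := by
    rw [← coboundary_cochainRes, cochainRes_extend]
  rw [h1, ← h.coboundary_apply_self, coboundary_coboundary]
  rfl

/-- The indicator cochain of the inserted simplex. -/
noncomputable def indicator (F : Type*) [Field F] (h : InsertSimplex K L σ) : Cochain F L :=
  Pi.single ⟨σ, h.mem⟩ 1

theorem cochainRes_indicator (h : InsertSimplex K L σ) :
    cochainRes F h.le (h.indicator F) = 0 := by
  classical
  funext τ
  refine Pi.single_eq_of_ne ?_ _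
  intro he
  have he' : τ.1 = σ := congrArg Subtype.val he
  exact h.1 (he' ▸ τ.2)

/-- The form `[α] ↦ α(∂ σ)` on cohomology. -/
noncomputable def connecting (F : Type*) [Field F] (h : InsertSimplex K L σ) :
    Cohomology F K →ₗ[F] F :=
  Submodule.liftQ _ (h.evalBoundary F ∘ₗ Submodule.subtype _) (by
    rintro ⟨α, hα⟩ ⟨γ, hγ⟩
    change h.evalBoundary F α = 0
    rw [← show coboundary F K γ = α from hγ, h.evalBoundary_coboundary])

/-- The classes that extend over `σ` are those on which the form `[α] ↦ α(∂ σ)` vanishes. -/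
theorem mem_range_iff (h : InsertSimplex K L σ) (v : Cohomology F K) :
    v ∈ LinearMap.range (cohomologyMap F h.le) ↔ h.connecting F v = 0 := by
  constructor
  · rintro ⟨w, rfl⟩
    obtain ⟨β, hβ, rfl⟩ := exists_cohClass_eq w
    exact (h.coboundary_eq_zero_iff.1 hβ).2
  · intro hv
    obtain ⟨α, hα, rfl⟩ := exists_cohClass_eq v
    exact ⟨cohClass (α.extend L) (h.coboundary_extend_eq_zero_iff.2 ⟨hα, hv⟩),
      cohomologyMap_cohClass _ _ _ (cochainRes_extend h.le α)⟩

/-- The cokernel of the restriction to the smaller complex is at most one-dimensional. -/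
theorem exists_mem_range (h : InsertSimplex K L σ) (u v : Cohomology F K) :
    ∃ a a' : F, (a ≠ 0 ∨ a' ≠ 0) ∧
      a • u + a' • v ∈ LinearMap.range (cohomologyMap F h.le) := by
  simp only [h.mem_range_iff, map_add, map_smul, smul_eq_mul]
  by_cases hu : h.connecting F u = 0
  · exact ⟨1, 0, Or.inl one_ne_zero, by simp [hu]⟩
  · exact ⟨h.connecting F v, -h.connecting F u, Or.inr (neg_ne_zero.2 hu), by ring⟩

theorem coboundary_indicator (h : InsertSimplex K L σ) : coboundary F L (h.indicator F) = 0 :=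
  h.coboundary_eq_zero_iff.2 (by simp [cochainRes_indicator])

/-- The kernel of the restriction to the smaller complex is spanned by the class of the indicator
cochain of the inserted simplex. -/
theorem exists_eq_smul (h : InsertSimplex K L σ) {u : Cohomology F L}
    (hu : cohomologyMap F h.le u = 0) :
    ∃ a : F, u = a • cohClass (h.indicator F) h.coboundary_indicator := by
  obtain ⟨β, hβ, rfl⟩ := exists_cohClass_eq u
  obtain ⟨γ, hγ⟩ := (cohClass_eq_zero_iff
    (show coboundary F K (cochainRes F h.le β) = 0 by rw [coboundary_cochainRes, hβ, map_zero])).1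
    hu
  refine ⟨β ⟨σ, h.mem⟩ - coboundary F L (γ.extend L) ⟨σ, h.mem⟩, ?_⟩
  rw [← sub_eq_zero]
  refine (cohClass_eq_zero_iff (α := β - (β ⟨σ, h.mem⟩ -
    coboundary F L (γ.extend L) ⟨σ, h.mem⟩) • h.indicator F) (by
      rw [map_sub, map_smul, hβ, h.coboundary_indicator, smul_zero, sub_zero])).2
    ⟨γ.extend L, h.ext_cochain ?_ ?_⟩
  · rw [← coboundary_cochainRes, cochainRes_extend, map_sub, map_smul, h.cochainRes_indicator,
      smul_zero, sub_zero, hγ]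
  · simp [indicator]

/-- The kernel of the restriction to the smaller complex is at most one-dimensional. -/
theorem exists_smul_add_smul_eq_zero (h : InsertSimplex K L σ) {u v : Cohomology F L}
    (hu : cohomologyMap F h.le u = 0) (hv : cohomologyMap F h.le v = 0) :
    ∃ a a' : F, (a ≠ 0 ∨ a' ≠ 0) ∧ a • u + a' • v = 0 := by
  obtain ⟨s, rfl⟩ := h.exists_eq_smul hu
  obtain ⟨t, rfl⟩ := h.exists_eq_smul hv
  by_cases hs : s = 0
  · exact ⟨1, 0, Or.inl one_ne_zero, by simp [hs]⟩
  · exact ⟨t, -s, Or.inr (neg_ne_zero.2 hs), by module⟩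

/-- If the restriction to the smaller complex is injective, the indicator cochain of `σ` is a
coboundary, and a cochain that it bounds does not vanish on `∂ σ`. -/
theorem connecting_ne_zero (h : InsertSimplex K L σ)
    (hinj : Function.Injective (cohomologyMap F h.le)) : h.connecting F ≠ 0 := by
  intro h0
  have h1 : cohClass (h.indicator F) h.coboundary_indicator = 0 := by
    apply hinj
    rw [map_zero, cohomologyMap_cohClass h.le _ (map_zero _) h.cochainRes_indicator]
    exact (cohClass_eq_zero_iff (map_zero _)).2 ⟨0, map_zero _⟩
  obtain ⟨β, hβ⟩ := (cohClass_eq_zero_iff _).1 h1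
  have hβK : coboundary F K (cochainRes F h.le β) = 0 := by
    rw [coboundary_cochainRes, hβ, h.cochainRes_indicator]
  have h2 : h.evalBoundary F (cochainRes F h.le β) = 0 :=
    LinearMap.congr_fun h0 (cohClass _ hβK)
  rw [← h.coboundary_apply_self, hβ] at h2
  simp [indicator] at h2

end InsertSimplex

end InsertSimplex

/-! ### The reversed reflection diamond -/

namespace ReversedReflection

variable {F : Type*} [Field F] {X : Type*} [LinearOrder X] {n : ℕ} {B T : ZigzagFiltration X n}
  {l i r : Fin (n + 1)} {σ : Finset X}

theorem l_lt_i (hR : ReversedReflection B T l i r σ) : l < i :=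
  Fin.lt_def.2 (by have := hR.l_add_one; omega)

theorem i_lt_r (hR : ReversedReflection B T l i r σ) : i < r :=
  Fin.lt_def.2 (by have := hR.i_add_one; omega)

/-- The vertices `l` and `i` are the ends of one arrow. -/
theorem exists_left (hR : ReversedReflection B T l i r σ) :
    ∃ k : Fin n, l = k.castSucc ∧ i = k.succ := by
  have h1 := hR.l_add_one
  have h2 := i.isLt
  exact ⟨⟨l, by omega⟩, rfl, Fin.ext (by simpa using h1.symm)⟩

/-- The vertices `i` and `r` are the ends of one arrow. -/
theorem exists_right (hR : ReversedReflection B T l i r σ) :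
    ∃ k : Fin n, i = k.castSucc ∧ r = k.succ := by
  have h1 := hR.i_add_one
  have h2 := r.isLt
  exact ⟨⟨i, by omega⟩, rfl, Fin.ext (by simpa using h1.symm)⟩

theorem cohomology_left_arrow (hR : ReversedReflection B T l i r σ) (k : Fin n)
    (hk : k.castSucc = l) : (B.cohomology F).forward k = false := by
  obtain ⟨k', rfl, rfl⟩ := hR.exists_left
  obtain rfl := Fin.castSucc_injective _ hk
  have h := hR.left_arrow k rfl
  change (!B.forward k) = false
  rw [h]
  rfl

theorem cohomology_right_arrow (hR : ReversedReflection B T l i r σ) (k : Fin n)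
    (hk : i ≤ k.castSucc) : (B.cohomology F).forward k = true := by
  have h : B.forward k = false := by
    rcases hk.eq_or_lt with hk | hk
    · exact hR.right_arrow k hk.symm
    · refine hR.suffix_arrow k (Fin.le_def.2 ?_)
      have h1 := hR.i_add_one
      rw [Fin.lt_def] at hk
      omega
  change (!B.forward k) = true
  rw [h]
  rfl

theorem le (hR : ReversedReflection B T l i r σ) (k : Fin (n + 1)) : B.K k ≤ T.K k := by
  by_cases hk : k = i
  · subst hk
    exact hR.le_top
  · exact (hR.top_eq k hk).ge

/-- The restriction of the top module to the bottom module. -/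
noncomputable def embedding (hR : ReversedReflection B T l i r σ)
    (hinj : Function.Injective (cohomologyMap F hR.le_top)) :
    ZigzagModule.Embedding (T.cohomology F) (B.cohomology F) where
  φ k := cohomologyMap F (hR.le k)
  injective k := by
    by_cases hk : k = i
    · subst hk
      exact hinj
    · exact (cohomologyMap_bijective_of_eq _ (hR.top_eq k hk).symm).1
  forward_eq := by
    funext k
    change (!T.forward k) = !B.forward k
    rw [hR.top_forward]
  φ_fmap k h' h v := (cohomologyMap_comp _ _ v).trans (cohomologyMap_comp _ _ v).symm
  φ_bmap k h' h v := (cohomologyMap_comp _ _ v).trans (cohomologyMap_comp _ _ v).symm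

/-- A representative sequence that is alive at `i` is alive at `l`, since the map between the two
vertices is an isomorphism. -/
theorem le_l (hR : ReversedReflection B T l i r σ) {x : ∀ k, (B.cohomology F).V k}
    {b d : Fin (n + 1)} (hx : (B.cohomology F).IsRepSeq x b d) (hi : x i ≠ 0) : b ≤ l := by
  have harrow := hR.cohomology_left_arrow (F := F)
  have heq := hR.left_eq
  obtain ⟨k, rfl, rfl⟩ := hR.exists_left
  have hk := harrow k rfl
  have h1 := hx.map_backward k hk hi
  refine ((hx.ne_zero_iff k.castSucc).1 ?_).1
  rw [← h1]
  intro h0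
  exact hi ((cohomologyMap_bijective_of_eq _ heq).1 (h0.trans (map_zero _).symm))

/-- A representative sequence that is alive at `i` is alive at `r`, since the map between the two
vertices is an isomorphism. -/
theorem r_le (hR : ReversedReflection B T l i r σ) {x : ∀ k, (B.cohomology F).V k}
    {b d : Fin (n + 1)} (hx : (B.cohomology F).IsRepSeq x b d) (hi : x i ≠ 0) : r ≤ d := by
  have harrow := hR.cohomology_right_arrow (F := F)
  have heq := hR.right_eq
  obtain ⟨k, rfl, rfl⟩ := hR.exists_right
  have hk := harrow k le_rfl
  have h1 := hx.map_forward k hk hi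
  refine ((hx.ne_zero_iff k.succ).1 ?_).2
  rw [← h1]
  intro h0
  exact hi ((cohomologyMap_bijective_of_eq _ heq).1 (h0.trans (map_zero _).symm))

theorem subsingleton_cohomology {K : PreAbstractSimplicialComplex X} (h : K.faces = ∅) :
    Subsingleton (Cohomology F K) := by
  have : IsEmpty K.faces := Set.isEmpty_coe_sort.2 h
  refine ⟨fun u v => ?_⟩
  obtain ⟨α, hα, rfl⟩ := exists_cohClass_eq u
  obtain ⟨β, hβ, rfl⟩ := exists_cohClass_eq v
  obtain rfl : α = β := Subsingleton.elim _ _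
  rfl

theorem birth_ne_zero (hR : ReversedReflection B T l i r σ) {x : ∀ k, (B.cohomology F).V k}
    {b d : Fin (n + 1)} (hx : (B.cohomology F).IsRepSeq x b d) : b ≠ 0 := by
  rintro rfl
  have := subsingleton_cohomology (F := F) hR.first
  exact (hx.ne_zero_iff 0).2 ⟨le_rfl, hx.le⟩ (Subsingleton.elim (α := Cohomology F (B.K 0)) _ _)

theorem death_ne_last (hR : ReversedReflection B T l i r σ) {x : ∀ k, (B.cohomology F).V k}
    {b d : Fin (n + 1)} (hx : (B.cohomology F).IsRepSeq x b d) : d ≠ Fin.last n := by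
  rintro rfl
  have := subsingleton_cohomology (F := F) hR.last
  exact (hx.ne_zero_iff (Fin.last n)).2 ⟨hx.le, le_rfl⟩
    (Subsingleton.elim (α := Cohomology F (B.K (Fin.last n))) _ _)

variable {κ : Type*} {x : κ → ∀ k, (B.cohomology F).V k} {b d : κ → Fin (n + 1)}

/-- Births up to `l` are distinct, since each of the arrows there inserts or deletes one simplex. -/
theorem birth_ne (hR : ReversedReflection B T l i r σ)
    (hx : (B.cohomology F).IsIntervalBasis x b d) {s t : κ} (hst : s ≠ t) (hs : b s ≤ l) :
    b s ≠ b t := by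
  intro he
  obtain ⟨k, hk⟩ := Fin.exists_succ_eq.2 (hR.birth_ne_zero (hx.isRepSeq s))
  rw [← hk] at hs
  by_cases hf : B.forward k = true
  · obtain ⟨τ, hτ⟩ := hR.prefix_forward k hs hf
    have hf' : (B.cohomology F).forward k = false := by
      change (!B.forward k) = false
      rw [hf]
      rfl
    exact hx.birth_ne_of_backward hst hf'
      (fun u v hu hv => hτ.exists_smul_add_smul_eq_zero hu hv) hk.symm (he ▸ hk.symm)
  · have hf : B.forward k = false := by simpa using hf
    obtain ⟨τ, hτ⟩ := hR.prefix_backward k hs hf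
    have hf' : (B.cohomology F).forward k = true := by
      change (!B.forward k) = true
      rw [hf]
      rfl
    exact hx.birth_ne_of_forward hst hf'
      (fun u v => hτ.exists_mem_range u v) hk.symm (he ▸ hk.symm)

/-- Deaths from `r` on are distinct, since each of the arrows there deletes one simplex. -/
theorem death_ne (hR : ReversedReflection B T l i r σ)
    (hx : (B.cohomology F).IsIntervalBasis x b d) {s t : κ} (hst : s ≠ t) (hs : r ≤ d s) :
    d s ≠ d t := by
  intro he
  obtain ⟨k, hk⟩ := Fin.exists_castSucc_eq.2 (hR.death_ne_last (hx.isRepSeq s))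
  rw [← hk] at hs
  obtain ⟨τ, hτ⟩ := hR.suffix_backward k hs
  exact hx.death_ne_of_forward hst (hR.cohomology_right_arrow k (hR.i_lt_r.le.trans hs))
    (fun u v hu hv => hτ.exists_smul_add_smul_eq_zero hu hv) hk.symm (he ▸ hk.symm)

/-- The class at `l` of a cocycle of `B.K i` is the entry at `l` of its representative sequence. -/
theorem cohomologyMap_extend_l (hR : ReversedReflection B T l i r σ)
    {x : ∀ k, (B.cohomology F).V k} {b d : Fin (n + 1)}
    (hx : (B.cohomology F).IsRepSeq x b d) {α : Cochain F (B.K i)}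
    (hα : coboundary F (B.K i) α = 0) (hi : x i = cohClass α hα) (hne : x i ≠ 0)
    (h : coboundary F (T.K l) (α.extend (T.K l)) = 0) :
    cohomologyMap F (hR.le l) (cohClass _ h) = x l := by
  have harrow := hR.cohomology_left_arrow (F := F)
  have hle := hR.le
  have heq := hR.left_eq
  obtain ⟨k, rfl, rfl⟩ := hR.exists_left
  have hk := harrow k rfl
  rw [← hx.map_backward k hk hne, hi]
  refine (cohomologyMap_cohClass _ h (β := cochainRes F heq.le α) ?_ ?_).trans
    (cohomologyMap_cohClass _ hα _ rfl).symm
  · rw [coboundary_cochainRes, hα, map_zero]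
  · exact cochainRes_extend_of_le _ _ _

/-- The class at `r` of a cocycle of `B.K i` is the entry at `r` of its representative sequence. -/
theorem cohomologyMap_extend_r (hR : ReversedReflection B T l i r σ)
    {x : ∀ k, (B.cohomology F).V k} {b d : Fin (n + 1)}
    (hx : (B.cohomology F).IsRepSeq x b d) {α : Cochain F (B.K i)}
    (hα : coboundary F (B.K i) α = 0) (hi : x i = cohClass α hα) (hne : x i ≠ 0)
    (h : coboundary F (T.K r) (α.extend (T.K r)) = 0) :
    cohomologyMap F (hR.le r) (cohClass _ h) = x r := by
  have harrow := hR.cohomology_right_arrow (F := F)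
  have hle := hR.le
  have heq := hR.right_eq
  obtain ⟨k, rfl, rfl⟩ := hR.exists_right
  have hk := harrow k le_rfl
  rw [← hx.map_forward k hk hne, hi]
  refine (cohomologyMap_cohClass _ h (β := cochainRes F heq.le α) ?_ ?_).trans
    (cohomologyMap_cohClass _ hα _ rfl).symm
  · rw [coboundary_cochainRes, hα, map_zero]
  · exact cochainRes_extend_of_le _ _ _

end ReversedReflection

/-! ### The update of the basis -/

theorem mainTheorem2 {F : Type*} [Field F] {X : Type*} [LinearOrder X] {n : ℕ}
    {B T : ZigzagFiltration X n} {l i r : Fin (n + 1)} {σ : Finset X}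
    (hR : ReversedReflection B T l i r σ)
    (hinj : Function.Injective (cohomologyMap F hR.le_top))
    {N : ℕ} (α : Fin N → Cochain F (B.K i)) (hα : ∀ j, coboundary F (B.K i) (α j) = 0)
    (b d : Fin N → Fin (n + 1))
    (D : (B.cohomology F).IntervalDecomposition)
    (hD : D.IsCompatibleBasis i (fun j => cohClass (α j) (hα j)) b d)
    (p : ℕ) (hpN : p ≤ N)
    (hp : ∀ j : Fin N, hR.coeff (α j) ≠ 0 ↔ (j : ℕ) < p)
    (hsort : ∀ j k : Fin N, j ≤ k → (k : ℕ) < p → (B.cohomology F).leD (d k) (d j)) :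
    Nonempty (GreedyRun (B.cohomology F) p α (fun j => hR.coeff (α j)) b d) ∧
    ∀ R : GreedyRun (B.cohomology F) p α (fun j => hR.coeff (α j)) b d,
      ∃ (hα' : ∀ j : {j : Fin N // j ≠ R.last},
            coboundary F (T.K i) ((R.α' j).extend (T.K i)) = 0)
        (hleft : coboundary F (T.K l) ((α (R.ℓ R.last)).extend (T.K l)) = 0)
        (hright : coboundary F (T.K r) ((α R.last).extend (T.K r)) = 0)
        (D' : (T.cohomology F).IntervalDecomposition),
        D'.IsCompatibleBasis i
          (fun j : {j : Fin N // j ≠ R.last} => cohClass ((R.α' j).extend (T.K i)) (hα' j))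
          (fun j => b (R.ℓ j)) (fun j => d j) ∧
        D'.Attached l (cohClass ((α (R.ℓ R.last)).extend (T.K l)) hleft) (b (R.ℓ R.last)) l ∧
        D'.Attached r (cohClass ((α R.last).extend (T.K r)) hright) r (d R.last) := by
  obtain ⟨S, hS, x, bS, dS, hx, hxi, hnot⟩ := hD.exists_isIntervalBasis
  have hxne : ∀ j, x (.inl j) i ≠ 0 := fun j => by
    rw [hxi]
    exact hD.linearIndependent.ne_zero j
  have hbl : ∀ j, b j ≤ l := fun j => hR.le_l (hx.isRepSeq (.inl j)) (hxne j)
  have hrd : ∀ j, r ≤ d j := fun j => hR.r_le (hx.isRepSeq (.inl j)) (hxne j)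
  have hconn := hR.top_insert.connecting_ne_zero hinj
  have hp0 : p ≠ 0 := by
    rintro rfl
    refine hconn (LinearMap.ext_on_range hD.span_eq_top fun j => ?_)
    by_contra h
    exact Nat.not_lt_zero _ ((hp j).1 h)
  constructor
  · exact GreedyRun.nonempty_of_sorted ⟨p - 1, by omega⟩ (Nat.sub_add_cancel (by omega))
      fun j k hjk hk => hsort j k hjk (by
        have := Fin.le_def.1 hk
        simp only at this
        omega)
  intro R
  have hlast := R.last_add_one
  have hle : ∀ j, j ≤ R.last ↔ hR.coeff (α j) ≠ 0 := fun j => by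
    rw [hp, Fin.le_def]
    omega
  -- the pivots and their coefficients
  have hpivot : ∀ j, ∃ (g : Fin N) (a : F), (j = R.last → a = 0) ∧
      (j ≠ R.last → R.α' j = α j - a • α g ∧ hR.coeff (α j) - a * hR.coeff (α g) = 0 ∧
        (a = 0 → R.ℓ j = j)) ∧
      (a ≠ 0 → g ≠ j ∧ d g ≤ d j ∧ ((R.ℓ j = j ∧ (B.cohomology F).leB (b g) (b j)) ∨
        (R.ℓ j = g ∧ (B.cohomology F).leB (b j) (b g)))) := by
    intro j
    rcases lt_trichotomy j R.last with hj | hj | hj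
    · obtain ⟨g, hg, hgj, hd, he, hb⟩ := R.exists_pivot (fun j k hjk hk => hsort j k hjk (by
        rw [Fin.le_def] at hk
        omega)) hj
      have hcg := (hle g).1 hg
      have hcj := (hle j).1 hj.le
      refine ⟨g, hR.coeff (α j) / hR.coeff (α g), fun h => absurd h hj.ne, fun _ =>
        ⟨he, ?_, fun h => absurd h (div_ne_zero hcj hcg)⟩, fun _ => ⟨hgj, ?_, hb⟩⟩
      · rw [div_mul_cancel₀ _ hcg, sub_self]
      · exact (ZigzagModule.leD_iff_of_forward _ (fun k hk =>
          hR.cohomology_right_arrow k (hR.i_lt_r.le.trans hk)) (hrd g) (hrd j)).1 hd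
    · exact ⟨j, 0, fun _ => rfl, fun h => absurd hj h, fun h => absurd rfl h⟩
    · have hc : hR.coeff (α j) = 0 := by
        by_contra h
        exact absurd ((hle j).2 h) hj.not_ge
      refine ⟨j, 0, fun _ => rfl, fun _ => ⟨?_, ?_, fun _ => (R.unchanged j hj).1⟩,
        fun h => absurd rfl h⟩
      · rw [(R.unchanged j hj).2, zero_smul, sub_zero]
      · rw [hc, zero_mul, sub_zero]
  choose g a ha hα' hpiv using hpivot
  have hcocycle : ∀ j ≠ R.last, coboundary F (B.K i) (R.α' j) = 0 := fun j hj => by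
    rw [(hα' j hj).1, map_sub, map_smul, hα, hα, smul_zero, sub_zero]
  have hext : ∀ j ≠ R.last, coboundary F (T.K i) ((R.α' j).extend (T.K i)) = 0 := fun j hj => by
    refine hR.top_insert.coboundary_extend_eq_zero_iff.2 ⟨hcocycle j hj, ?_⟩
    rw [(hα' j hj).1, map_sub, map_smul, smul_eq_mul]
    exact (hα' j hj).2.1
  let U : ZigzagModule.UpdateData (B.cohomology F) l i r N S :=
    { x := x
      b := Sum.elim b bS
      d := Sum.elim d dS
      ℓ := Equiv.ofBijective R.ℓ (Finite.injective_iff_bijective.1 R.ℓ_injective)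
      last := R.last
      g := g
      a := a
      l_lt := hR.l_lt_i
      lt_r := hR.i_lt_r
      le_or := fun k => by
        have h1 := hR.l_add_one
        have h2 := hR.i_add_one
        rw [Fin.le_def, Fin.le_def, Fin.ext_iff]
        omega
      left_arrow := hR.cohomology_left_arrow
      right_arrow := hR.cohomology_right_arrow
      isIntervalBasis := hx
      b_le := hbl
      le_d := hrd
      not_mem := hnot
      b_injective := fun j j' h => by
        by_contra hne
        exact hR.birth_ne hx (Sum.inl_injective.ne hne) (hbl j) h
      d_injective := fun j j' h => by
        by_contra hne
        exact hR.death_ne hx (Sum.inl_injective.ne hne) (hrd j) h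
      a_last := ha _ rfl
      ℓ_eq := fun j hj => (hα' j hj).2.2
      pivot_ne := fun j h => (hpiv j h).1
      d_pivot := fun j h => (hpiv j h).2.1
      b_pivot := fun j h => (hpiv j h).2.2 }
  have hw : ∀ j : {j // j ≠ R.last}, cohomologyMap F (hR.le i) (cohClass _ (hext j j.2)) =
      cohClass (α j) (hα j) - a j • cohClass (α (g j)) (hα (g j)) := fun j => by
    refine (cohomologyMap_cohClass _ _ (hcocycle j j.2) (cochainRes_extend _ _)).trans ?_
    simp only [(hα' j j.2).1]
    rfl
  obtain ⟨D', hD', hDl, hDr⟩ := U.exists_decomposition (hR.embedding hinj)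
    (fun k hk => (cohomologyMap_bijective_of_eq _ (hR.top_eq k hk).symm).2) hconn
    (fun v => (hR.top_insert.mem_range_iff _).1 ⟨v, rfl⟩)
    (w := fun j => cohClass _ (hext j j.2)) (fun j => (hw j).trans (by
      change _ = x (.inl j) i - a j • x (.inl (g j)) i
      rw [hxi, hxi]
      rfl))
  have hl := coboundary_extend_of_eq
    (((hR.top_eq l hR.l_lt_i.ne).trans hR.left_eq).symm) (hα (R.ℓ R.last))
  have hr := coboundary_extend_of_eq
    (((hR.top_eq r hR.i_lt_r.ne').trans hR.right_eq).symm) (hα R.last)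
  refine ⟨fun j => hext j j.2, hl, hr, D', hD', hDl _ ?_, hDr _ ?_⟩
  · exact hR.cohomologyMap_extend_l (hx.isRepSeq (.inl (R.ℓ R.last))) (hα _) (hxi _) (hxne _) hl
  · exact hR.cohomologyMap_extend_r (hx.isRepSeq (.inl R.last)) (hα _) (hxi _) (hxne _) hr
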